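/- Let $(\mathcal A,\varphi)$ be a non-commutative probability space ($\mathcal A$ a unital complex algebra, $\varphi:\mathcal A\to\mathbb C$ linear with $\varphi(1)=1$) with $\varphi(xy)=\varphi(yx)$ for all $x,y\in\mathcal A$. Let $n\ge 1$, and let $s$, $\{b_1,\dots,b_n\}$ and $\{d_0,d_1,\dots,d_n\}$ be free in $(\mathcal A,\varphi)$, i.e. all mixed free cumulants of elements of these three families vanish. Let $s$ be standard semicircular: $\varphi(s^k)=\frac{k!}{(k/2)!\,(k/2+1)!}$ for even $k$ and $\varphi(s^k)=0$ for odd $k$. Write $NC(m)$ for the set of non-crossing partitions of $\{1,\dots,m\}$ and $NC_2(m)$ for the set of those all of whose blocks have two elements. For $\pi\in NC(m)$ let $\varphi_\pi[a_1,\dots,a_m]=\prod_{V\in\pi}\varphi(a_{i_1}a_{i_2}\cdots a_{i_r})$, where $V=\{i_1<\cdots<i_r\}$, and let $K(\pi)\in NC(m)$ be the Kreweras complement, i.e. the largest non-crossing partition $\sigma$ of $\{\bar1,\dots,\bar m\}\cong\{1,\dots,m\}$ for which $\pi\cup\sigma$ is non-crossing on $1<\bar1<2<\bar2<\cdots<m<\bar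 m$. (a) $$\varphi(d_0sb_1sd_1sb_2sd_2\cdots sb_nsd_n)=\sum_{\pi\in NC_2(2n)}\varphi_{K(\pi)}[b_1,d_1,b_2,d_2,\dots,b_n,d_nd_0]$$ $$=\sum_{\pi\in NC(n)}\varphi_\pi[b_1,b_2,\dots,b_n]\,\varphi_{K(\pi)}[d_1,\dots,d_{n-1},d_nd_0]$$ $$=\sum_{\pi\in NC(n)}\varphi_\pi[d_1,\dots,d_{n-1},d_nd_0]\,\varphi_{K(\pi)}[b_2,\dots,b_n,b_1].$$ (b) Let $t\ge 0$ and $1=k_0<k_1<\cdots<k_t\le n$, and let $\mathcal S$ be the set of all $\pi\in NC_2(2n)$ such that $\{2k_i,2k_{i+1}-1\}\in\pi$ for $0\le i<t$ and $\{2k_t,2k_0-1\}=\{2k_t,1\}\in\pi$. Then $$\sum_{\pi\in\mathcal S}\varphi_{K(\pi)}[b_1,d_1,\dots,b_n,d_nd_0]=\varphi(b_{k_0}b_{k_1}\cdots b_{k_t})\prod_{i=1}^{t+1}\varphi\bigl(d_{k_{i-1}}sb_{k_{i-1}+1}sd_{k_{i-1}+1}\cdots sb_{k_i-1}sd_{k_i-1}\bigr),$$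 where in the product on the right $k_{t+1}=n+1$ and the last letter $d_n$ of the factor $i=t+1$ is replaced by $d_nd_0$ (so this factor is $\varphi(d_nd_0)$ if $k_t=n$, and a factor with $k_i=k_{i-1}+1\le n$ is $\varphi(d_{k_{i-1}})$). -/

import Mathlib

open Finset

noncomputable section

namespace FreeMoments

/-- Partitions of `{1, …, n}`; the label `i` is the element `i - 1` of `Fin n`. -/
abbrev Part (n : ℕ) := Finpartition (Finset.univ : Finset (Fin n))

/-- `π` is non-crossing: there are no `i < j < k < l` with `i, k` in one block and `j, l` in another. -/
def IsNonCrossing {n : ℕ} (π : Part n) : Prop :=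
  ∀ V ∈ π.parts, ∀ W ∈ π.parts, ∀ i j k l : Fin n,
    i < j → j < k → k < l → i ∈ V → k ∈ V → j ∈ W → l ∈ W → V = W

open Classical in
/-- `NC(n)`. -/
def NC (n : ℕ) : Finset (Part n) := {π | IsNonCrossing π}

open Classical in
/-- `NC₂(m)`: the non-crossing partitions of `{1, …, m}` all of whose blocks have two elements. -/
def NC₂ (m : ℕ) : Finset (Part m) := {π ∈ NC m | ∀ V ∈ π.parts, V.card = 2}

/-- Put `1, 1', 2, 2', …, n, n'` on a line. The points `i'` and `j'` are related when no block of `π`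
has points on both sides of the chord from `i'` to `j'`; the point `x` lies under this chord
exactly when one, and only one, of `x ≤ i`, `x ≤ j` holds. -/
def krewerasSetoid {n : ℕ} (π : Part n) : Setoid (Fin n) where
  r i j := ∀ V ∈ π.parts, ∀ x ∈ V, ∀ y ∈ V, ((x ≤ i ↔ x ≤ j) ↔ (y ≤ i ↔ y ≤ j))
  iseqv :=
    { refl := fun _ _ _ _ _ _ _ => by simp
      symm := fun h V hV x hx y hy => by
        have := h V hV x hx y hy
        tauto
      trans := fun h h' V hV x hx y hy => by
        have := h V hV x hx y hy
        have := h' V hV x hx y hy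
        tauto }

open Classical in
/-- The Kreweras complement `K(π)`; see `kreweras_isGreatest`. -/
def kreweras {n : ℕ} (π : Part n) : Part n := Finpartition.ofSetoid (krewerasSetoid π)

/-- For `π` on `1, …, n` and `σ` on `1', …, n'`, no block of `π` crosses a block of `σ` when the
points are ordered as `1 < 1' < 2 < 2' < ⋯ < n < n'`. -/
def NoMutualCrossing {n : ℕ} (π σ : Part n) : Prop :=
  ∀ V ∈ π.parts, ∀ W ∈ σ.parts, ∀ x ∈ V, ∀ y ∈ V, ∀ i ∈ W, ∀ j ∈ W,
    ¬ (x ≤ i ∧ i < y ∧ y ≤ j) ∧ ¬ (i < x ∧ x ≤ j ∧ j < y)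

/-- `K(π)` is the largest non-crossing partition `σ` of `1', …, n'` such that `π ∪ σ` is a non-crossing
partition of `1, 1', …, n, n'`. -/
theorem kreweras_isGreatest {n : ℕ} (π : Part n) :
    IsGreatest {σ : Part n | IsNonCrossing σ ∧ NoMutualCrossing π σ} (kreweras π) := by
  classical
  have key : ∀ W ∈ (kreweras π).parts, ∀ i ∈ W, ∀ j, j ∈ W ↔ (krewerasSetoid π).r i j := by
    intro W hW i hi j
    have h1 : W = (kreweras π).part i := ((kreweras π).part_eq_of_mem hW hi).symm
    rw [h1]
    exact Finpartition.mem_part_ofSetoid_iff_rel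
  refine ⟨⟨?_, ?_⟩, ?_⟩
  · intro V hV W hW i j k l hij hjk hkl hi hk hj hl
    have hik := (key V hV i hi k).1 hk
    have hjl := (key W hW j hj l).1 hl
    refine (kreweras π).eq_of_mem_parts hV hW hk ((key W hW j hj k).2 ?_)
    intro U hU x hx y hy
    have h1 := hik U hU x hx y hy
    have h2 := hjl U hU x hx y hy
    grind
  · intro V hV W hW x hx y hy i hi j hj
    have h := (key W hW i hi j).1 hj V hV x hx y hy
    grind
  · rintro σ ⟨-, hσ⟩ W hW
    obtain ⟨i, hi⟩ := σ.nonempty_of_mem_parts hW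
    refine ⟨(kreweras π).part i, (kreweras π).part_mem.2 (Finset.mem_univ i), ?_⟩
    intro j hj
    refine (key _ ((kreweras π).part_mem.2 (Finset.mem_univ i)) i
      ((kreweras π).mem_part (Finset.mem_univ i)) j).2 ?_
    intro V hV x hx y hy
    have h1 := hσ V hV W hW x hx y hy i hi j hj
    have h2 := hσ V hV W hW x hx y hy j hj i hi
    have h3 := hσ V hV W hW y hy x hx i hi j hj
    have h4 := hσ V hV W hW y hy x hx j hj i hi
    grind

variable {A : Type*} [Ring A] [Algebra ℂ A]

/-- `φ(a₁ a₂ ⋯ aₙ)`. -/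
def moment (φ : A →ₗ[ℂ] ℂ) {n : ℕ} (a : Fin n → A) : ℂ := φ (List.ofFn a).prod

/-- The tuple `(a_{i₁}, …, a_{iᵣ})` for `V = {i₁ < ⋯ < iᵣ}`. -/
def restrict {n : ℕ} (a : Fin n → A) (V : Finset (Fin n)) : Fin V.card → A :=
  fun i => a (V.orderEmbOfFin rfl i)

/-- `φ_π[a₁, …, aₙ]`, the product over the blocks `V = {i₁ < ⋯ < iᵣ}` of `φ(a_{i₁} ⋯ a_{iᵣ})`. -/
def partMoment (φ : A →ₗ[ℂ] ℂ) {n : ℕ} (π : Part n) (a : Fin n → A) : ℂ :=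
  ∏ V ∈ π.parts, moment φ (restrict a V)

theorem card_lt_of_mem_parts {n : ℕ} {π : Part n} (hπ : π ≠ ⊤) {V : Finset (Fin n)}
    (hV : V ∈ π.parts) : V.card < n := by
  by_contra h
  have hu : V = Finset.univ := Finset.eq_univ_of_card V (by
    have := Finset.card_le_univ V
    simp only [Fintype.card_fin] at this ⊢
    omega)
  subst hu
  refine hπ (top_le_iff.1 ?_)
  intro W hW
  exact ⟨Finset.univ, hV, Finset.subset_univ _⟩

open Classical in
/-- The free cumulants, obtained from the moments by solving the moment-cumulant relation
`φ(a₁ ⋯ aₙ) = ∑_{π ∈ NC(n)} ∏_{V ∈ π} κ[a|V]` for the term of the one-block partition. -/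
def freeCumulant (φ : A →ₗ[ℂ] ℂ) (n : ℕ) (a : Fin n → A) : ℂ :=
  moment φ a - ∑ π : {π : Part n // π ∈ NC n ∧ π ≠ ⊤}, ∏ V : {V // V ∈ π.1.parts},
    freeCumulant φ V.1.card (restrict a V.1)
termination_by n
decreasing_by exact card_lt_of_mem_parts π.2.2 V.2

/-- The sets `S i` of variables are free: every mixed free cumulant of their elements vanishes. -/
def AreFree (φ : A →ₗ[ℂ] ℂ) {ι : Type*} (S : ι → Set A) : Prop :=
  ∀ (m : ℕ) (a : Fin m → A) (c : Fin m → ι),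
    (∀ i, a i ∈ S (c i)) → (∃ i j, c i ≠ c j) → freeCumulant φ m a = 0

/-- `s` is a standard semicircular variable, by its moments. -/
def IsSemicircular (φ : A →ₗ[ℂ] ℂ) (s : A) : Prop :=
  ∀ k : ℕ, φ (s ^ k) =
    if Even k then (k.factorial : ℂ) / ((k / 2).factorial * (k / 2 + 1).factorial) else 0

/-- `d_k s b_{k+1} s d_{k+1} s b_{k+2} s d_{k+2} ⋯ s b_l s d_l` for `k ≤ l` (it is `d_k` for `k = l`). -/
def word (s : A) (b d : ℕ → A) (k l : ℕ) : A :=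
  d k * ((List.range' (k + 1) (l - k)).map fun i => s * b i * s * d i).prod

/-- The family `d₁, …, d_{n-1}, dₙ d₀`. -/
def closeUp (n : ℕ) (d : ℕ → A) : ℕ → A := Function.update d n (d n * d 0)

/-- The tuple `(x₁, …, xₙ)`. -/
def tuple (n : ℕ) (x : ℕ → A) : Fin n → A := fun i => x (i + 1)

/-- The tuple `(x₂, …, xₙ, x₁)`. -/
def rotTuple (n : ℕ) (x : ℕ → A) : Fin n → A := fun i => x ((i + 1) % n + 1)

/-- The tuple `(x₁, y₁, x₂, y₂, …, xₙ, yₙ)`. -/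
def altTuple (n : ℕ) (x y : ℕ → A) : Fin (2 * n) → A :=
  fun i => if (i : ℕ) % 2 = 0 then x (i / 2 + 1) else y (i / 2 + 1)

/-- `{p, q} ∈ π`, for labels `p, q ∈ {1, …, m}`. -/
def HasPair {m : ℕ} (π : Part m) (p q : ℕ) : Prop :=
  ∃ V ∈ π.parts, V.image (fun x : Fin m => (x : ℕ) + 1) = {p, q}

open Classical in
/-- The `π ∈ NC₂(2n)` with `{2kᵢ, 2kᵢ₊₁ - 1} ∈ π` for `0 ≤ i ≤ t`, where `k_{t+1} = k₀`. -/
def chainPairings (n t : ℕ) (k : ℕ → ℕ) : Finset (Part (2 * n)) :=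
  {π ∈ NC₂ (2 * n) |
    (∀ i < t, HasPair π (2 * k i) (2 * k (i + 1) - 1)) ∧ HasPair π (2 * k t) (2 * k 0 - 1)}

end FreeMoments

end

/-!
Put `z = (b₁, d₁, …, bₙ, dₙ d₀)`. Only cumulants of pairs of `s` survive, so the moments of words
in `s` and letters free from `s` satisfy the Schwinger–Dyson equations: contracting the first `s`
with another one splits the word into two. On the other side, cut a non-crossing partition at the
block of its first point. The blocks of the Kreweras complement are the classes of the slots between
the points that no block separates, and they split along with the partition. So the sums over
`NC₂(2n)` and over `NC(n)` obey recursions that the Schwinger–Dyson equations match term by term.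
The two sums over `NC(n)` differ by a cyclic rotation of the word, which the trace allows. For a
prescribed chain of pairs every cut of the recursion is forced, and the sum over the pairings that
contain it factors into the gaps of the chain, each of which is again the moment of a word.
-/

open Finset

noncomputable section

namespace FreeMoments

section Classes

variable {α : Type*} {r r' : Setoid α} {s t : Finset α} {p j : α}

theorem disjoint_of_forall_subset {P Q : Finset (Finset α)} (hP : ∀ U ∈ P, U.Nonempty ∧ U ⊆ s)
    (hQ : ∀ U ∈ Q, U ⊆ t) (hst : Disjoint s t) : Disjoint P Q :=
  disjoint_left.2 fun _ hUP hUQ => (hP _ hUP).1.ne_empty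
    (disjoint_self_iff_empty _ |>.1 (hst.mono (hP _ hUP).2 (hQ _ hUQ)))

variable [DecidableEq α]

open Classical in
/-- The equivalence classes of `r` inside the finite set `s`. -/
def classes (r : Setoid α) (s : Finset α) : Finset (Finset α) := s.image fun i => {k ∈ s | r i k}

theorem mem_classes {W : Finset α} :
    W ∈ classes r s ↔ ∃ i ∈ s, ∀ k, k ∈ W ↔ k ∈ s ∧ r i k := by
  simp only [classes, mem_image, Finset.ext_iff, mem_filter]
  exact exists_congr fun i => and_congr_right fun _ => forall_congr' fun k => Iff.comm

theorem subset_of_mem_classes {W : Finset α} (hW : W ∈ classes r s) : W ⊆ s := by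
  obtain ⟨i, -, hi⟩ := mem_classes.1 hW
  exact fun k hk => ((hi k).1 hk).1

theorem nonempty_of_mem_classes {W : Finset α} (hW : W ∈ classes r s) : W.Nonempty := by
  obtain ⟨i, his, hi⟩ := mem_classes.1 hW
  exact ⟨i, (hi i).2 ⟨his, r.refl i⟩⟩

theorem classes_congr (h : ∀ i ∈ s, ∀ k ∈ s, r i k ↔ r' i k) : classes r s = classes r' s := by
  classical
  exact image_congr fun i hi => filter_congr fun k hk => h i hi k hk

theorem disjoint_classes (h : Disjoint s t) : Disjoint (classes r s) (classes r' t) :=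
  disjoint_of_forall_subset
    (fun _ hU => ⟨nonempty_of_mem_classes hU, subset_of_mem_classes hU⟩)
    (fun _ hU => subset_of_mem_classes hU) h

/-- Adjoin `p` to a block if it contains `j`: applied to all blocks of a partition, this puts the
new element `p` into the block of `j`. -/
def adjoin (p j : α) (U : Finset α) : Finset α := if j ∈ U then insert p U else U

theorem classes_union (h : ∀ i ∈ s, ∀ k ∈ t, ¬ r i k) :
    classes r (s ∪ t) = classes r s ∪ classes r t := by
  classical
  rw [classes, image_union]
  congr 1 <;> refine image_congr fun i hi => ?_
  · exact (filter_union _ _ _).trans (union_eq_left.2 fun k hk => absurd (mem_filter.1 hk).2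
      (h i hi k (mem_filter.1 hk).1))
  · exact (filter_union _ _ _).trans (union_eq_right.2 fun k hk => absurd
      (r.symm (mem_filter.1 hk).2) (h k (mem_filter.1 hk).1 i hi))

theorem classes_insert (hj : j ∈ s) (hpj : r p j) :
    classes r (insert p s) = (classes r s).image (adjoin p j) := by
  classical
  have hclass : ∀ i, ({k ∈ insert p s | r i k} : Finset α) = adjoin p j {k ∈ s | r i k} := by
    intro i
    have hij : r i p ↔ r i j := ⟨fun h => r.trans h hpj, fun h => r.trans h (r.symm hpj)⟩
    simp only [adjoin, mem_filter, hj, true_and, filter_insert, hij]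
  rw [classes, image_insert, insert_eq_of_mem, classes, image_image]
  · exact image_congr fun i _ => hclass i
  · exact mem_image.2 ⟨j, hj, filter_congr fun k _ =>
      ⟨fun h => r.trans hpj h, fun h => r.trans (r.symm hpj) h⟩⟩

theorem adjoin_subset {U : Finset α} (hU : U ⊆ s) : adjoin p j U ⊆ insert p s := by
  unfold adjoin
  split_ifs
  exacts [insert_subset_insert _ hU, hU.trans (subset_insert _ _)]

theorem subset_adjoin (U : Finset α) : U ⊆ adjoin p j U := by
  unfold adjoin
  split_ifs
  exacts [subset_insert _ _, Subset.rfl]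

theorem mem_adjoin {U : Finset α} {x : α} : x ∈ adjoin p j U ↔ x ∈ U ∨ x = p ∧ j ∈ U := by
  unfold adjoin
  split_ifs with h <;> simp [h, or_comm]

theorem erase_adjoin {U : Finset α} (hU : p ∉ U) : (adjoin p j U).erase p = U := by
  ext x
  have : x ∈ U → x ≠ p := fun hx hxp => hU (hxp ▸ hx)
  simp only [mem_erase, mem_adjoin]
  tauto

theorem adjoin_erase {U : Finset α} (hjp : j ≠ p) (hU : p ∈ U ↔ j ∈ U) :
    adjoin p j (U.erase p) = U := by
  ext x
  rcases eq_or_ne x p with rfl | hx <;> simp_all [mem_adjoin]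

theorem adjoin_injOn {P : Finset (Finset α)} (hP : ∀ U ∈ P, p ∉ U) :
    Set.InjOn (adjoin p j) (P : Set (Finset α)) := fun U hU W hW h => by
  rw [← erase_adjoin (j := j) (hP U hU), h, erase_adjoin (hP W hW)]

theorem prod_image_adjoin {R : Type*} [CommMonoid R] {P : Finset (Finset α)}
    (hP : ∀ U ∈ P, p ∉ U) (f : Finset α → R) :
    ∏ U ∈ P.image (adjoin p j), f U = ∏ U ∈ P, (f ∘ adjoin p j) U :=
  prod_image (adjoin_injOn hP)

end Classes

section NonCrossing

/-- `P` is a non-crossing partition of the finite set `s` of natural numbers. Partitions are kept as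
unbundled families of blocks, so that partitions of different sets can be combined freely. The weak
inequalities in `eq_of_le` make it express both disjointness and absence of crossings. -/
structure IsNCPartition (s : Finset ℕ) (P : Finset (Finset ℕ)) : Prop where
  nonempty : ∀ U ∈ P, U.Nonempty
  mem_iff : ∀ x, x ∈ s ↔ ∃ U ∈ P, x ∈ U
  eq_of_le : ∀ U ∈ P, ∀ W ∈ P, ∀ i ∈ U, ∀ j ∈ W, ∀ k ∈ U, ∀ l ∈ W, i ≤ j → j ≤ k → k ≤ l → U = W

open Classical in
/-- The set of non-crossing partitions of `s`. -/
def ncPartitions (s : Finset ℕ) : Finset (Finset (Finset ℕ)) :=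
  {P ∈ s.powerset.powerset | IsNCPartition s P}

/-- `i` and `j` lie in the same block of `P`. -/
def Linked (P : Finset (Finset ℕ)) (i j : ℕ) : Prop := ∃ U ∈ P, i ∈ U ∧ j ∈ U

/-- Slot `i` is the gap just after the point `i`. Two slots are equivalent when no block of `P` has
points on both sides of the chord joining them, so that the classes of slots form the Kreweras
complement of `P`. -/
def slotSetoid (P : Finset (Finset ℕ)) : Setoid ℕ where
  r i j := ∀ U ∈ P, ∀ x ∈ U, ∀ y ∈ U, ((x ≤ i ↔ x ≤ j) ↔ (y ≤ i ↔ y ≤ j))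
  iseqv :=
    { refl := by simp
      symm := fun h U hU x hx y hy => by have := h U hU x hx y hy; tauto
      trans := fun h h' U hU x hx y hy => by
        have := h U hU x hx y hy
        have := h' U hU x hx y hy
        tauto }

variable {s t : Finset ℕ} {P Q : Finset (Finset ℕ)} {p j q : ℕ}

theorem IsNCPartition.subset (h : IsNCPartition s P) {U : Finset ℕ} (hU : U ∈ P) : U ⊆ s :=
  fun _ hx => (h.mem_iff _).2 ⟨U, hU, hx⟩

theorem IsNCPartition.eq_of_mem (h : IsNCPartition s P) {U W : Finset ℕ} (hU : U ∈ P) (hW : W ∈ P)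
    {x : ℕ} (hxU : x ∈ U) (hxW : x ∈ W) : U = W :=
  h.eq_of_le U hU W hW x hxU x hxW x hxU x hxW le_rfl le_rfl le_rfl

theorem mem_ncPartitions : P ∈ ncPartitions s ↔ IsNCPartition s P := by
  simp only [ncPartitions, mem_filter, mem_powerset, and_iff_right_iff_imp]
  exact fun h U hU => mem_powerset.2 (h.subset hU)

theorem ncPartitions_empty : ncPartitions ∅ = {∅} := by
  ext P
  rw [mem_ncPartitions, mem_singleton]
  refine ⟨fun h => eq_empty_of_forall_notMem fun U hU => ?_, ?_⟩
  · exact (h.nonempty U hU).ne_empty (subset_empty.1 (h.subset hU))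
  · rintro rfl
    exact ⟨by simp, by simp, by simp⟩

theorem IsNCPartition.filter_subset (h : IsNCPartition s P) (hts : t ⊆ s)
    (hsplit : ∀ U ∈ P, U ⊆ t ∨ Disjoint U t) : IsNCPartition t {U ∈ P | U ⊆ t} where
  nonempty U hU := h.nonempty U (mem_filter.1 hU).1
  mem_iff x := by
    refine ⟨fun hx => ?_, fun ⟨U, hU, hxU⟩ => (mem_filter.1 hU).2 hxU⟩
    obtain ⟨U, hU, hxU⟩ := (h.mem_iff x).1 (hts hx)
    exact ⟨U, mem_filter.2 ⟨hU, (hsplit U hU).resolve_right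
      fun hd => disjoint_left.1 hd hxU hx⟩, hxU⟩
  eq_of_le U hU W hW := h.eq_of_le U (mem_filter.1 hU).1 W (mem_filter.1 hW).1

theorem IsNCPartition.union (hP : IsNCPartition s P) (hQ : IsNCPartition t Q)
    (hst : ∀ x ∈ s, ∀ y ∈ t, x < y) : IsNCPartition (s ∪ t) (P ∪ Q) where
  nonempty U hU := (mem_union.1 hU).elim (hP.nonempty U) (hQ.nonempty U)
  mem_iff x := by
    simp only [mem_union, hP.mem_iff x, hQ.mem_iff x, or_and_right, exists_or]
  eq_of_le U hU W hW i hi j hj k hk l hl hij hjk hkl := by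
    rcases mem_union.1 hU with hU | hU <;> rcases mem_union.1 hW with hW | hW
    · exact hP.eq_of_le U hU W hW i hi j hj k hk l hl hij hjk hkl
    · exact absurd hjk (hst k (hP.subset hU hk) j (hQ.subset hW hj)).not_ge
    · exact absurd hij (hst j (hP.subset hW hj) i (hQ.subset hU hi)).not_ge
    · exact hQ.eq_of_le U hU W hW i hi j hj k hk l hl hij hjk hkl

theorem filter_subset_union_left (hP : IsNCPartition s P) (hQ : IsNCPartition t Q)
    (hst : Disjoint s t) : {U ∈ P ∪ Q | U ⊆ s} = P := by
  rw [filter_union, filter_true_of_mem fun U hU => hP.subset hU, filter_false_of_mem, union_empty]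
  intro U hU hUs
  obtain ⟨x, hx⟩ := hQ.nonempty U hU
  exact disjoint_left.1 hst (hUs hx) (hQ.subset hU hx)

open Classical in
theorem sum_ncPartitions_union {R : Type*} [AddCommMonoid R] (hst : ∀ x ∈ s, ∀ y ∈ t, x < y)
    (F : Finset (Finset ℕ) → R) :
    ∑ P ∈ ncPartitions (s ∪ t) with ∀ U ∈ P, U ⊆ s ∨ U ⊆ t, F P =
      ∑ P ∈ ncPartitions s, ∑ Q ∈ ncPartitions t, F (P ∪ Q) := by
  have hd : Disjoint s t := disjoint_left.2 fun x hs ht => (hst x hs x ht).false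
  rw [← sum_product']
  refine sum_nbij' (fun P => (({U ∈ P | U ⊆ s} : Finset _), ({U ∈ P | U ⊆ t} : Finset _)))
    (fun PQ => PQ.1 ∪ PQ.2) ?_ ?_ ?_ ?_ ?_ <;>
    simp only [mem_filter, mem_product, mem_ncPartitions, and_imp, Prod.forall]
  · exact fun P hP hsplit => ⟨hP.filter_subset subset_union_left fun U hU =>
        (hsplit U hU).imp_right fun h => (hd.mono_right h).symm,
      hP.filter_subset subset_union_right fun U hU => (hsplit U hU).symm.imp_right hd.mono_left⟩
  · exact fun P Q hP hQ => ⟨hP.union hQ hst, fun U hU =>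
      (mem_union.1 hU).imp hP.subset hQ.subset⟩
  · exact fun P _ hsplit => by rw [← filter_or, filter_true_of_mem hsplit]
  · intro P Q hP hQ
    rw [filter_subset_union_left hP hQ hd, union_comm P, filter_subset_union_left hQ hP hd.symm]
  · exact fun P _ hsplit => by rw [← filter_or, filter_true_of_mem hsplit]

open Classical in
/-- The non-crossing partitions of `{p, …, q}` with `p` and `q` in the same block. -/
def linkedPartitions (p q : ℕ) : Finset (Finset (Finset ℕ)) :=
  {P ∈ ncPartitions (Icc p q) | Linked P p q}

theorem mem_linkedPartitions :
    P ∈ linkedPartitions p q ↔ IsNCPartition (Icc p q) P ∧ Linked P p q := by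
  simp only [linkedPartitions, mem_filter, mem_ncPartitions]

theorem linked_union_left (hQ : IsNCPartition t Q) (hp : p ∉ t) :
    Linked (P ∪ Q) p j ↔ Linked P p j := by
  refine ⟨?_, fun ⟨U, hU, h⟩ => ⟨U, mem_union_left _ hU, h⟩⟩
  rintro ⟨U, hU, hpU, hjU⟩
  exact ⟨U, (mem_union.1 hU).resolve_right fun h => hp (hQ.subset h hpU), hpU, hjU⟩

/-- `j` is the largest element of the block of `p`. -/
theorem IsNCPartition.existsUnique_split_first (hP : IsNCPartition (Ico p q) P) (hpq : p < q) :
    ∃! j, j ∈ Ico p q ∧ (∀ U ∈ P, U ⊆ Icc p j ∨ U ⊆ Ioo j q) ∧ Linked P p j := by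
  obtain ⟨U, hU, hpU⟩ := (hP.mem_iff p).1 (left_mem_Ico.2 hpq)
  have hmax : U.max' ⟨p, hpU⟩ ∈ U := max'_mem _ _
  set m := U.max' ⟨p, hpU⟩
  refine ⟨m, ⟨hP.subset hU hmax, fun W hW => ?_, U, hU, hpU, hmax⟩, ?_⟩
  · by_cases hWm : ∃ x ∈ W, x ≤ m
    · obtain ⟨x, hx, hxm⟩ := hWm
      refine Or.inl fun y hy => mem_Icc.2 ⟨(mem_Ico.1 (hP.subset hW hy)).1, ?_⟩
      by_contra! hmy
      obtain rfl := hP.eq_of_le U hU W hW p hpU x hx m hmax y hy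
        (mem_Ico.1 (hP.subset hW hx)).1 hxm hmy.le
      exact (U.le_max' y hy).not_gt hmy
    · push Not at hWm
      exact Or.inr fun y hy => mem_Ioo.2 ⟨hWm y hy, (mem_Ico.1 (hP.subset hW hy)).2⟩
  · rintro j ⟨hj, hsplit, W, hW, hpW, hjW⟩
    obtain rfl := hP.eq_of_mem hU hW hpU hpW
    have hUj : U ⊆ Icc p j := (hsplit U hU).resolve_right fun h =>
      absurd (mem_Ico.1 hj).1 (mem_Ioo.1 (h hpU)).1.not_ge
    exact (U.le_max' j hjW).antisymm (mem_Icc.1 (hUj hmax)).2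

/-- `j` is the smallest element of the block of `q`. -/
theorem IsNCPartition.existsUnique_split_last (hP : IsNCPartition (Ioc p q) P) (hpq : p < q) :
    ∃! j, j ∈ Ioc p q ∧ (∀ U ∈ P, U ⊆ Ioo p j ∨ U ⊆ Icc j q) ∧ Linked P j q := by
  obtain ⟨U, hU, hqU⟩ := (hP.mem_iff q).1 (right_mem_Ioc.2 hpq)
  have hmin : U.min' ⟨q, hqU⟩ ∈ U := min'_mem _ _
  set m := U.min' ⟨q, hqU⟩
  refine ⟨m, ⟨hP.subset hU hmin, fun W hW => ?_, U, hU, hmin, hqU⟩, ?_⟩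
  · by_cases hWm : ∃ x ∈ W, m ≤ x
    · obtain ⟨x, hx, hmx⟩ := hWm
      refine Or.inr fun y hy => mem_Icc.2 ⟨?_, (mem_Ioc.1 (hP.subset hW hy)).2⟩
      by_contra! hym
      obtain rfl := hP.eq_of_le W hW U hU y hy m hmin x hx q hqU hym.le hmx
        (mem_Ioc.1 (hP.subset hW hx)).2
      exact (W.min'_le y hy).not_gt hym
    · push Not at hWm
      exact Or.inl fun y hy => mem_Ioo.2 ⟨(mem_Ioc.1 (hP.subset hW hy)).1, hWm y hy⟩
  · rintro j ⟨hj, hsplit, W, hW, hjW, hqW⟩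
    obtain rfl := hP.eq_of_mem hU hW hqU hqW
    have hUj : U ⊆ Icc j q := (hsplit U hU).resolve_left fun h =>
      absurd (mem_Ioc.1 hj).2 (mem_Ioo.1 (h hqU)).2.not_ge
    exact (mem_Icc.1 (hUj hmin)).1.antisymm (U.min'_le j hjW)

theorem sum_eq_sum_sum_filter_of_existsUnique {ι κ R : Type*} [AddCommMonoid R] {s : Finset ι}
    {t : Finset κ} {r : ι → κ → Prop} [∀ i k, Decidable (r i k)]
    (h : ∀ i ∈ s, ∃! k, k ∈ t ∧ r i k) (F : ι → R) :
    ∑ i ∈ s, F i = ∑ k ∈ t, ∑ i ∈ s with r i k, F i := by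
  simp only [sum_filter]
  rw [sum_comm]
  refine sum_congr rfl fun i hi => ?_
  obtain ⟨k, ⟨hk, hik⟩, huniq⟩ := h i hi
  rw [sum_eq_single_of_mem k hk fun l hl hlk => if_neg fun hil => hlk (huniq l ⟨hl, hil⟩),
    if_pos hik]

theorem sum_ncPartitions_Ico {R : Type*} [AddCommMonoid R] (hpq : p < q)
    (F : Finset (Finset ℕ) → R) :
    ∑ P ∈ ncPartitions (Ico p q), F P =
      ∑ j ∈ Ico p q, ∑ P ∈ linkedPartitions p j, ∑ Q ∈ ncPartitions (Ioo j q), F (P ∪ Q) := by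
  classical
  rw [sum_eq_sum_sum_filter_of_existsUnique
    fun P hP => (mem_ncPartitions.1 hP).existsUnique_split_first hpq]
  refine sum_congr rfl fun j hj => ?_
  have hunion : Icc p j ∪ Ioo j q = Ico p q := by grind
  rw [← filter_filter, sum_filter, ← hunion, sum_ncPartitions_union (by grind), linkedPartitions,
    sum_filter]
  refine sum_congr rfl fun P _ => ?_
  rw [sum_congr rfl fun Q hQ => by
    rw [linked_union_left (mem_ncPartitions.1 hQ) (by grind)], sum_ite_irrel, sum_const_zero]

theorem sum_ncPartitions_Ioc {R : Type*} [AddCommMonoid R] (hpq : p < q)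
    (F : Finset (Finset ℕ) → R) :
    ∑ P ∈ ncPartitions (Ioc p q), F P =
      ∑ j ∈ Ioc p q, ∑ P ∈ ncPartitions (Ioo p j), ∑ Q ∈ linkedPartitions j q, F (P ∪ Q) := by
  classical
  rw [sum_eq_sum_sum_filter_of_existsUnique
    fun P hP => (mem_ncPartitions.1 hP).existsUnique_split_last hpq]
  refine sum_congr rfl fun j hj => ?_
  have hunion : Ioo p j ∪ Icc j q = Ioc p q := by grind
  rw [← filter_filter, sum_filter, ← hunion, sum_ncPartitions_union (by grind)]
  refine sum_congr rfl fun P hP => ?_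
  rw [linkedPartitions, sum_filter]
  refine sum_congr rfl fun Q _ => ?_
  rw [union_comm, linked_union_left (mem_ncPartitions.1 hP) (by grind)]

theorem IsNCPartition.image_adjoin (hP : IsNCPartition (Ioc p q) P) (hpq : p < q) :
    IsNCPartition (Icc p q) (P.image (adjoin p q)) where
  nonempty := forall_mem_image.2 fun U hU => (hP.nonempty U hU).mono (subset_adjoin U)
  mem_iff x := by
    obtain ⟨V, hV, hqV⟩ := (hP.mem_iff q).1 (right_mem_Ioc.2 hpq)
    rw [← Ioc_insert_left hpq.le, mem_insert, hP.mem_iff, exists_mem_image]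
    simp only [mem_adjoin]
    constructor
    · rintro (rfl | ⟨U, hU, hx⟩)
      exacts [⟨V, hV, .inr ⟨rfl, hqV⟩⟩, ⟨U, hU, .inl hx⟩]
    · rintro ⟨U, hU, hx | ⟨rfl, -⟩⟩
      exacts [.inr ⟨U, hU, hx⟩, .inl rfl]
  eq_of_le := by
    have hbound : ∀ U ∈ P, ∀ x ∈ U, p < x ∧ x ≤ q := fun U hU x hx => mem_Ioc.1 (hP.subset hU hx)
    have hcross := hP.eq_of_le
    refine forall_mem_image.2 fun U hU => forall_mem_image.2 fun W hW => ?_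
    intro i hi j hj k hk l hl hij hjk hkl
    congr 1
    rw [mem_adjoin] at hi hj hk hl
    by_cases hqU : q ∈ U <;> by_cases hqW : q ∈ W <;> grind

theorem IsNCPartition.linked_iff (hP : IsNCPartition s P) (hlink : Linked P p q) {U : Finset ℕ}
    (hU : U ∈ P) : p ∈ U ↔ q ∈ U := by
  obtain ⟨W, hW, hpW, hqW⟩ := hlink
  exact ⟨fun h => hP.eq_of_mem hW hU hpW h ▸ hqW, fun h => hP.eq_of_mem hW hU hqW h ▸ hpW⟩

theorem IsNCPartition.image_erase (hP : IsNCPartition (Icc p q) P) (hpq : p < q)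
    (hlink : Linked P p q) : IsNCPartition (Ioc p q) (P.image (erase · p)) where
  nonempty := by
    refine forall_mem_image.2 fun U hU => ?_
    obtain ⟨x, hx⟩ := hP.nonempty U hU
    rcases eq_or_ne x p with rfl | hxp
    · exact ⟨q, mem_erase.2 ⟨hpq.ne', (hP.linked_iff hlink hU).1 hx⟩⟩
    · exact ⟨x, mem_erase.2 ⟨hxp, hx⟩⟩
  mem_iff x := by
    simp only [← Icc_erase_left, mem_erase, hP.mem_iff, exists_mem_image, ← exists_and_left,
      and_left_comm]
  eq_of_le := by
    refine forall_mem_image.2 fun U hU => forall_mem_image.2 fun W hW => ?_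
    intro i hi j hj k hk l hl hij hjk hkl
    exact congrArg (erase · p) (hP.eq_of_le U hU W hW i (mem_of_mem_erase hi) j
      (mem_of_mem_erase hj) k (mem_of_mem_erase hk) l (mem_of_mem_erase hl) hij hjk hkl)

theorem sum_linkedPartitions {R : Type*} [AddCommMonoid R] (hpq : p < q)
    (F : Finset (Finset ℕ) → R) :
    ∑ P ∈ linkedPartitions p q, F P =
      ∑ P ∈ ncPartitions (Ioc p q), F (P.image (adjoin p q)) := by
  symm
  refine sum_nbij' (·.image (adjoin p q)) (·.image (erase · p)) ?_ ?_ ?_ ?_ fun _ _ => rfl <;>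
    simp only [mem_ncPartitions, mem_linkedPartitions, and_imp]
  · intro P hP
    obtain ⟨U, hU, hqU⟩ := (hP.mem_iff q).1 (right_mem_Ioc.2 hpq)
    exact ⟨hP.image_adjoin hpq, adjoin p q U, mem_image_of_mem _ hU, mem_adjoin.2 (.inr ⟨rfl, hqU⟩),
      subset_adjoin U hqU⟩
  · exact fun P hP hlink => hP.image_erase hpq hlink
  · intro P hP
    rw [image_image]
    exact (image_congr fun U hU => erase_adjoin fun hpU =>
      left_notMem_Ioc (hP.subset hU hpU)).trans image_id
  · intro P hP hlink
    rw [image_image]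
    exact (image_congr fun U hU => adjoin_erase hpq.ne' (hP.linked_iff hlink hU)).trans image_id

end NonCrossing

section Sums

variable {R : Type*} [CommSemiring R] {f f' g g' : Finset ℕ → R} {p j q : ℕ}
  {P Q : Finset (Finset ℕ)}

/-- The product of the weights `f` of the blocks of `P` and `g` of its classes of slots in `S`. -/
def weight (f g : Finset ℕ → R) (S : Finset ℕ) (P : Finset (Finset ℕ)) : R :=
  (∏ U ∈ P, f U) * ∏ W ∈ classes (slotSetoid P) S, g W

/-- The sum of the weights of the non-crossing partitions of the points `p + 1, …, q - 1`, with the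
slots `p, …, q - 1` around them. -/
def openSum (f g : Finset ℕ → R) (p q : ℕ) : R :=
  ∑ P ∈ ncPartitions (Ioo p q), weight f g (Ico p q) P

/-- The sum of the weights of the non-crossing partitions of the points `p, …, q` that have `p` and
`q` in the same block, with the slots `p, …, q - 1` between them. -/
def closedSum (f g : Finset ℕ → R) (p q : ℕ) : R :=
  ∑ P ∈ linkedPartitions p q, weight f g (Ico p q) P

theorem openSum_congr (hf : ∀ U ⊆ Ioo p q, f U = f' U) (hg : ∀ W ⊆ Ico p q, g W = g' W) :
    openSum f g p q = openSum f' g' p q :=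
  sum_congr rfl fun _ hP => congrArg₂ _
    (prod_congr rfl fun U hU => hf U ((mem_ncPartitions.1 hP).subset hU))
    (prod_congr rfl fun W hW => hg W (subset_of_mem_classes hW))

theorem closedSum_congr (hf : ∀ U ⊆ Icc p q, f U = f' U) (hg : ∀ W ⊆ Ico p q, g W = g' W) :
    closedSum f g p q = closedSum f' g' p q :=
  sum_congr rfl fun _ hP => congrArg₂ _
    (prod_congr rfl fun U hU => hf U ((mem_linkedPartitions.1 hP).1.subset hU))
    (prod_congr rfl fun W hW => hg W (subset_of_mem_classes hW))

theorem openSum_succ (f g : Finset ℕ → R) (p : ℕ) : openSum f g p (p + 1) = g {p} := by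
  have hIoo : Ioo p (p + 1) = ∅ := by grind
  have hIco : Ico p (p + 1) = {p} := by grind
  simp [openSum, weight, classes, hIoo, hIco, ncPartitions_empty, filter_singleton]

theorem linkedPartitions_self (p : ℕ) : linkedPartitions p p = {{{p}}} := by
  ext P
  rw [mem_linkedPartitions, Icc_self, mem_singleton]
  constructor
  · rintro ⟨hP, U, hU, -⟩
    have hsub : ∀ W ∈ P, W = {p} := fun W hW =>
      (subset_singleton_iff.1 (hP.subset hW)).resolve_left (hP.nonempty W hW).ne_empty
    exact eq_singleton_iff_unique_mem.2 ⟨hsub U hU ▸ hU, hsub⟩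
  · rintro rfl
    exact ⟨⟨by simp, by simp, by simp⟩, {p}, by simp⟩

theorem closedSum_self (f g : Finset ℕ → R) (p : ℕ) : closedSum f g p p = f {p} := by
  simp [closedSum, weight, classes, linkedPartitions_self]

theorem slotSetoid_union_left {i k : ℕ} (h : ∀ U ∈ Q, ∀ x ∈ U, x ≤ i ↔ x ≤ k) :
    slotSetoid (P ∪ Q) i k ↔ slotSetoid P i k := by
  refine ⟨fun hik U hU => hik U (mem_union_left _ hU), fun hik U hU => ?_⟩
  rcases mem_union.1 hU with hU | hU
  · exact hik U hU
  · exact fun x hx y hy => iff_of_true (h U hU x hx) (h U hU y hy)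

theorem classes_union_of_linked (hP : IsNCPartition (Icc (p + 1) j) P)
    (hlink : Linked P (p + 1) j) (hQ : IsNCPartition (Ioo j q) Q) (hpj : p < j) (hjq : j < q) :
    classes (slotSetoid (P ∪ Q)) (Ico p q) =
      classes (slotSetoid P) (Ico (p + 1) j) ∪
        (classes (slotSetoid Q) (Ico j q)).image (adjoin p j) := by
  have hPb : ∀ U ∈ P, ∀ x ∈ U, p < x ∧ x ≤ j := fun U hU x hx => mem_Icc.1 (hP.subset hU hx)
  have hQb : ∀ U ∈ Q, ∀ x ∈ U, j < x ∧ x < q := fun U hU x hx => mem_Ioo.1 (hQ.subset hU hx)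
  obtain ⟨V, hV, hpV, hjV⟩ := hlink
  have hslots : Ico p q = Ico (p + 1) j ∪ insert p (Ico j q) := by grind
  have hpj' : slotSetoid (P ∪ Q) p j := fun U hU x hx y hy => by grind
  rw [hslots, classes_union, classes_insert (left_mem_Ico.2 hjq) hpj']
  · congr 1
    · exact classes_congr fun i hi k hk => slotSetoid_union_left fun U hU x hx => by grind
    · rw [union_comm,
        classes_congr fun i hi k hk => slotSetoid_union_left fun U hU x hx => by grind]
  · intro i hi k hk hik
    have := hik V (mem_union_left _ hV) (p + 1) hpV j hjV
    grind

theorem classes_union_image_adjoin (hP : IsNCPartition (Ioo p j) P)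
    (hQ : IsNCPartition (Icc j q) Q) (hpj : p < j) (hjq : j ≤ q) :
    classes (slotSetoid (P ∪ Q.image (adjoin p j))) (Ico p q) =
      classes (slotSetoid P) (Ico p j) ∪ classes (slotSetoid Q) (Ico j q) := by
  have hPb : ∀ U ∈ P, ∀ x ∈ U, p < x ∧ x < j := fun U hU x hx => mem_Ioo.1 (hP.subset hU hx)
  have hQb : ∀ U ∈ Q, ∀ x ∈ U, j ≤ x ∧ x ≤ q := fun U hU x hx => mem_Icc.1 (hQ.subset hU hx)
  have hQb' : ∀ U ∈ Q.image (adjoin p j), ∀ x ∈ U, x = p ∨ j ≤ x :=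
    forall_mem_image.2 fun U hU x hx =>
      (mem_adjoin.1 hx).symm.imp And.left fun h => (hQb U hU x h).1
  rw [← Ico_union_Ico_eq_Ico hpj.le hjq, classes_union]
  · congr 1
    · exact classes_congr fun i hi k hk => slotSetoid_union_left fun U hU x hx => by grind
    · refine classes_congr fun i hi k hk => ?_
      rw [union_comm, slotSetoid_union_left fun U hU x hx => by grind]
      change (∀ U ∈ _, _) ↔ ∀ U ∈ _, _
      rw [forall_mem_image]
      refine forall₂_congr fun U hU => ⟨fun h x hx y hy => h x (subset_adjoin U hx) y
        (subset_adjoin U hy), fun h x hx y hy => ?_⟩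
      rw [mem_adjoin] at hx hy
      grind
  · intro i hi k hk hik
    obtain ⟨V, hV, hjV⟩ := (hQ.mem_iff j).1 (left_mem_Icc.2 hjq)
    have := hik _ (mem_union_right _ (mem_image_of_mem _ hV)) p (mem_adjoin.2 (.inr ⟨rfl, hjV⟩)) j
      (subset_adjoin V hjV)
    grind

theorem openSum_eq_sum (f g : Finset ℕ → R) (hpq : p + 1 < q) :
    openSum f g p q =
      ∑ j ∈ Ioo p q, closedSum f g (p + 1) j * openSum f (g ∘ adjoin p j) j q := by
  have hIoo : Ioo p q = Ico (p + 1) q := by grind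
  simp only [openSum, closedSum, hIoo, sum_ncPartitions_Ico hpq, sum_mul_sum]
  refine sum_congr rfl fun j hj => sum_congr rfl fun P hP => sum_congr rfl fun Q hQ => ?_
  obtain ⟨hP, hlink⟩ := mem_linkedPartitions.1 hP
  rw [mem_ncPartitions] at hQ
  obtain ⟨hpj, hjq⟩ := mem_Ico.1 hj
  have hblocks : Disjoint P Q := disjoint_of_forall_subset
    (fun U hU => ⟨hP.nonempty U hU, hP.subset hU⟩) (fun _ hU => hQ.subset hU)
    (disjoint_left.2 (by grind))
  have hclasses : Disjoint (classes (slotSetoid P) (Ico (p + 1) j))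
      ((classes (slotSetoid Q) (Ico j q)).image (adjoin p j)) := disjoint_of_forall_subset
    (fun W hW => ⟨nonempty_of_mem_classes hW, subset_of_mem_classes hW⟩)
    (forall_mem_image.2 fun W hW => adjoin_subset (subset_of_mem_classes hW))
    (disjoint_left.2 (by grind))
  rw [weight, classes_union_of_linked hP hlink hQ hpj hjq, prod_union hblocks, prod_union hclasses,
    prod_image_adjoin fun W hW hpW => absurd (subset_of_mem_classes hW hpW) (by grind)]
  exact mul_mul_mul_comm ..

theorem closedSum_eq_sum (f g : Finset ℕ → R) (hpq : p < q) :
    closedSum f g p q =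
      ∑ j ∈ Ioc p q, openSum f g p j * closedSum (f ∘ adjoin p j) g j q := by
  simp only [openSum, closedSum, sum_linkedPartitions hpq, sum_ncPartitions_Ioc hpq, sum_mul_sum]
  refine sum_congr rfl fun j hj => sum_congr rfl fun P hP => sum_congr rfl fun Q hQ => ?_
  obtain ⟨hQ, hlink⟩ := mem_linkedPartitions.1 hQ
  rw [mem_ncPartitions] at hP
  obtain ⟨hpj, hjq⟩ := mem_Ioc.1 hj
  have himage : (P ∪ Q).image (adjoin p q) = P ∪ Q.image (adjoin p j) := by
    rw [image_union]
    congr 1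
    · exact (image_congr fun U hU => if_neg fun hqU =>
        absurd (mem_Ioo.1 (hP.subset hU hqU)).2 hjq.not_gt).trans image_id
    · exact image_congr fun U hU => by simp only [adjoin, hQ.linked_iff hlink hU]
  have hblocks : Disjoint P (Q.image (adjoin p j)) := disjoint_of_forall_subset
    (fun U hU => ⟨hP.nonempty U hU, hP.subset hU⟩)
    (forall_mem_image.2 fun U hU => adjoin_subset (hQ.subset hU)) (disjoint_left.2 (by grind))
  have hclasses := disjoint_classes (r := slotSetoid P) (r' := slotSetoid Q)
    (Ico_disjoint_Ico_consecutive p j q)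
  rw [weight, himage, classes_union_image_adjoin hP hQ hpj hjq, prod_union hblocks,
    prod_union hclasses, prod_image_adjoin fun U hU hpU => absurd (hQ.subset hU hpU) (by grind)]
  exact mul_mul_mul_comm ..

theorem closedSum_eq_zero (hf : ∀ U ⊆ Icc p q, p ∈ U → q ∈ U → f U = 0) :
    closedSum f g p q = 0 := by
  refine sum_eq_zero fun P hP => ?_
  obtain ⟨hP, U, hU, hpU, hqU⟩ := mem_linkedPartitions.1 hP
  rw [weight, prod_eq_zero hU (hf U (hP.subset hU) hpU hqU), zero_mul]

theorem closedSum_eq_mul_of_pair (hpq : p < q)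
    (hf : ∀ U ⊆ Icc p q, p ∈ U → q ∈ U → U ≠ {p, q} → f U = 0) :
    closedSum f g p q = f {p, q} * openSum f g p q := by
  rw [closedSum_eq_sum f g hpq, sum_eq_single_of_mem q (right_mem_Ioc.2 hpq), closedSum_self,
    mul_comm]
  · simp [adjoin]
  · intro j hj hjq
    rw [mem_Ioc] at hj
    rw [closedSum_eq_zero, mul_zero]
    intro U hU hjU hqU
    have hadj : adjoin p j U = insert p U := if_pos hjU
    refine hf _ (by grind) (by grind) (by grind) fun h => ?_
    have : j ∈ ({p, q} : Finset ℕ) := h ▸ subset_adjoin U hjU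
    grind

theorem openSum_eq_sum_of_pairs (hpq : p + 1 < q)
    (hf : ∀ U ⊆ Ioo p q, p + 1 ∈ U → #U ≠ 2 → f U = 0) :
    openSum f g p q = ∑ j ∈ Ioo (p + 1) q,
      f {p + 1, j} * openSum f g (p + 1) j * openSum f (g ∘ adjoin p j) j q := by
  have hIoo : Ioo p q = insert (p + 1) (Ioo (p + 1) q) := by grind
  rw [openSum_eq_sum f g hpq, hIoo, sum_insert left_notMem_Ioo, closedSum_self,
    hf {p + 1} (by grind) (by simp) (by simp), zero_mul, zero_add]
  refine sum_congr rfl fun j hj => ?_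
  obtain ⟨hpj, hjq⟩ := mem_Ioo.1 hj
  rw [closedSum_eq_mul_of_pair hpj]
  refine fun U hU hpU hjU hne => hf U (by grind) hpU fun hcard => hne ?_
  exact (eq_of_subset_of_card_le (by grind) (by rw [hcard, card_pair hpj.ne])).symm

theorem openSum_eq_mul_of_pair (hpj : p + 1 < j) (hjq : j < q)
    (hf : ∀ U, p + 1 ∈ U → U ≠ {p + 1, j} → f U = 0) :
    openSum f g p q =
      f {p + 1, j} * openSum f g (p + 1) j * openSum f (g ∘ adjoin p j) j q := by
  rw [openSum_eq_sum f g (hpj.trans hjq), sum_eq_single_of_mem j (by grind),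
    closedSum_eq_mul_of_pair hpj fun U _ hpU _ hne => hf U hpU hne]
  intro i _ hij
  rw [closedSum_eq_zero fun U hU hpU hiU => hf U hpU ?_, zero_mul]
  rintro rfl
  have := hU (mem_insert_of_mem (mem_singleton_self j))
  grind

end Sums

section Transfer

variable {n : ℕ} {π : Part n} {e : Fin n ↪o ℕ}

/-- The blocks of `π` transported along the order embedding `e`: a partition of the range of `e`. -/
def mapBlocks (e : Fin n ↪o ℕ) (π : Part n) : Finset (Finset ℕ) :=
  π.parts.map (mapEmbedding e.toEmbedding).toEmbedding

theorem mem_mapBlocks {U : Finset ℕ} :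
    U ∈ mapBlocks e π ↔ ∃ V ∈ π.parts, V.map e.toEmbedding = U := by
  simp [mapBlocks]

theorem forall_mem_mapBlocks {C : Finset ℕ → Prop} :
    (∀ U ∈ mapBlocks e π, C U) ↔ ∀ V ∈ π.parts, C (V.map e.toEmbedding) := by
  simp [mapBlocks]

theorem prod_mapBlocks {R : Type*} [CommMonoid R] (e : Fin n ↪o ℕ) (π : Part n)
    (f : Finset ℕ → R) : ∏ U ∈ mapBlocks e π, f U = ∏ V ∈ π.parts, f (V.map e.toEmbedding) := by
  simp [mapBlocks]

theorem mapBlocks_injective (e : Fin n ↪o ℕ) : Function.Injective (mapBlocks e) :=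
  fun _ _ h => Finpartition.ext (map_injective _ h)

theorem isNCPartition_mapBlocks :
    IsNCPartition (univ.map e.toEmbedding) (mapBlocks e π) ↔ IsNonCrossing π := by
  constructor
  · intro h V hV W hW i j k l hij hjk hkl hi hk hj hl
    have := h.eq_of_le _ (mem_mapBlocks.2 ⟨V, hV, rfl⟩) _ (mem_mapBlocks.2 ⟨W, hW, rfl⟩)
      (e i) (mem_map_of_mem _ hi) (e j) (mem_map_of_mem _ hj) (e k) (mem_map_of_mem _ hk)
      (e l) (mem_map_of_mem _ hl)
    simp only [e.le_iff_le] at this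
    exact map_injective _ (this hij.le hjk.le hkl.le)
  · refine fun h => ⟨forall_mem_mapBlocks.2 fun V hV => map_nonempty.2 (π.nonempty_of_mem_parts hV),
      fun x => ?_, ?_⟩
    · constructor
      · intro hx
        obtain ⟨i, -, rfl⟩ := mem_map.1 hx
        exact ⟨_, mem_mapBlocks.2 ⟨_, π.part_mem.2 (mem_univ i), rfl⟩,
          mem_map_of_mem _ (π.mem_part (mem_univ i))⟩
      · rintro ⟨U, hU, hx⟩
        obtain ⟨V, -, rfl⟩ := mem_mapBlocks.1 hU
        exact map_subset_map.2 (subset_univ V) hx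
    · simp only [forall_mem_mapBlocks, forall_mem_map, RelEmbedding.coe_toEmbedding, e.le_iff_le]
      intro V hV W hW i hi j hj k hk l hl hij hjk hkl
      rcases hij.eq_or_lt with rfl | hij
      · rw [π.eq_of_mem_parts hV hW hi hj]
      rcases hjk.eq_or_lt with rfl | hjk
      · rw [π.eq_of_mem_parts hV hW hk hj]
      rcases hkl.eq_or_lt with rfl | hkl
      · rw [π.eq_of_mem_parts hV hW hk hl]
      rw [h V hV W hW i j k l hij hjk hkl hi hk hj hl]

theorem IsNCPartition.exists_mapBlocks_eq {P : Finset (Finset ℕ)}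
    (hP : IsNCPartition (univ.map e.toEmbedding) P) : ∃ π : Part n, mapBlocks e π = P := by
  let restr : Finset ℕ → Finset (Fin n) := fun U => {i | e i ∈ U}
  have hmap : ∀ U ∈ P, (restr U).map e.toEmbedding = U := by
    intro U hU
    ext x
    simp only [restr, mem_map, mem_filter_univ, RelEmbedding.coe_toEmbedding]
    refine ⟨by rintro ⟨i, hi, rfl⟩; exact hi, fun hx => ?_⟩
    obtain ⟨i, -, rfl⟩ := mem_map.1 (hP.subset hU hx)
    exact ⟨i, hx, rfl⟩
  have hunique : ∀ i ∈ univ, ∃! V ∈ P.image restr, i ∈ V := by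
    intro i hi
    obtain ⟨U, hU, hiU⟩ := (hP.mem_iff (e i)).1 (mem_map_of_mem _ hi)
    refine ⟨restr U, ⟨mem_image_of_mem _ hU, by simpa [restr] using hiU⟩, ?_⟩
    rintro V ⟨hV, hiV⟩
    obtain ⟨W, hW, rfl⟩ := mem_image.1 hV
    rw [hP.eq_of_mem hU hW hiU (by simpa [restr] using hiV)]
  have hempty : ∅ ∉ P.image restr := by
    intro h
    obtain ⟨U, hU, hrestr⟩ := mem_image.1 h
    have := hP.nonempty U hU
    rw [← hmap U hU, hrestr] at this
    simp at this
  refine ⟨Finpartition.ofExistsUnique (P.image restr) (fun _ _ => subset_univ _) hunique hempty, ?_⟩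
  change (P.image restr).map _ = P
  rw [map_eq_image, image_image]
  exact (image_congr hmap).trans image_id

theorem mem_NC : π ∈ NC n ↔ IsNonCrossing π := by simp [NC]

theorem sum_NC_mapBlocks {R : Type*} [AddCommMonoid R] (e : Fin n ↪o ℕ)
    (F : Finset (Finset ℕ) → R) :
    ∑ π ∈ NC n, F (mapBlocks e π) = ∑ P ∈ ncPartitions (univ.map e.toEmbedding), F P := by
  have hNC : ∀ π, π ∈ NC n ↔ mapBlocks e π ∈ ncPartitions (univ.map e.toEmbedding) := fun π => by
    rw [mem_NC, mem_ncPartitions, isNCPartition_mapBlocks]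
  refine sum_bij (fun π _ => mapBlocks e π) (fun π => (hNC π).1)
    (fun _ _ _ _ h => mapBlocks_injective e h) (fun P hP => ?_) fun _ _ => rfl
  obtain ⟨π, rfl⟩ := (mem_ncPartitions.1 hP).exists_mapBlocks_eq
  exact ⟨π, (hNC π).2 hP, rfl⟩

theorem slotSetoid_mapBlocks {i j : Fin n} :
    slotSetoid (mapBlocks e π) (e i) (e j) ↔ krewerasSetoid π i j := by
  change (∀ U ∈ mapBlocks e π, _) ↔ ∀ V ∈ π.parts, _
  simp only [forall_mem_mapBlocks, forall_mem_map, RelEmbedding.coe_toEmbedding, e.le_iff_le]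

theorem mapBlocks_kreweras (e : Fin n ↪o ℕ) (π : Part n) :
    mapBlocks e (kreweras π) =
      classes (slotSetoid (mapBlocks e π)) (univ.map e.toEmbedding) := by
  classical
  have hpart : ∀ i k, k ∈ ((kreweras π).part i).map e.toEmbedding ↔
      k ∈ univ.map e.toEmbedding ∧ slotSetoid (mapBlocks e π) (e i) k := by
    intro i k
    constructor
    · intro hk
      obtain ⟨j, hj, rfl⟩ := mem_map.1 hk
      exact ⟨mem_map_of_mem _ (mem_univ j),
        slotSetoid_mapBlocks.2 (Finpartition.mem_part_ofSetoid_iff_rel.1 hj)⟩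
    · rintro ⟨hk, hik⟩
      obtain ⟨j, -, rfl⟩ := mem_map.1 hk
      exact mem_map_of_mem _
        (Finpartition.mem_part_ofSetoid_iff_rel.2 (slotSetoid_mapBlocks.1 hik))
  ext W
  rw [mem_mapBlocks, mem_classes]
  constructor
  · rintro ⟨V, hV, rfl⟩
    obtain ⟨i, hi⟩ := (kreweras π).nonempty_of_mem_parts hV
    exact ⟨e i, mem_map_of_mem _ (mem_univ i), (kreweras π).part_eq_of_mem hV hi ▸ hpart i⟩
  · rintro ⟨x, hx, hW⟩
    obtain ⟨i, hi, rfl⟩ := mem_map.1 hx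
    exact ⟨_, (kreweras π).part_mem.2 hi, Finset.ext fun k => (hpart i k).trans (hW k).symm⟩

end Transfer

section Subwords

variable {A : Type*} {n : ℕ} {x y : ℕ → A} {U : Finset ℕ}

/-- The list `x i₁, …, x iᵣ` for `U = {i₁ < ⋯ < iᵣ}`. -/
def letters (x : ℕ → A) (U : Finset ℕ) : List A := U.sort.map x

theorem letters_congr (h : ∀ i ∈ U, x i = y i) : letters x U = letters y U :=
  List.map_congr_left fun i hi => h i ((mem_sort _).1 hi)

theorem letters_singleton (x : ℕ → A) (i : ℕ) : letters x {i} = [x i] := by simp [letters]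

theorem letters_const (a : A) (U : Finset ℕ) : letters (fun _ => a) U = List.replicate #U a := by
  rw [letters, List.map_const', length_sort]

theorem letters_eq_ofFn (x : ℕ → A) (U : Finset ℕ) :
    letters x U = List.ofFn (x ∘ U.orderEmbOfFin rfl) := by
  rw [letters, ← U.listMap_orderEmbOfFin_finRange rfl, List.map_map, List.ofFn_eq_map]

theorem letters_insert_min (x : ℕ → A) {p : ℕ} (hp : ∀ i ∈ U, p < i) :
    letters x (insert p U) = x p :: letters x U := by
  rw [letters, sort_insert _ (fun i hi => (hp i hi).le) fun h => (hp p h).false]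
  rfl

theorem letters_map (x : ℕ → A) (e : Fin n ↪o ℕ) (V : Finset (Fin n)) :
    letters x (V.map e.toEmbedding) = List.ofFn (restrict (x ∘ e) V) := by
  have hsort : (V.map e.toEmbedding).sort = V.sort.map e :=
    (e.strictMono.strictMonoOn _).map_finsetSort (f := e.toEmbedding).symm
  rw [letters, hsort, List.map_map, ← V.listMap_orderEmbOfFin_finRange rfl, List.map_map,
    List.ofFn_eq_map]
  rfl

variable [Ring A] [Algebra ℂ A] {φ : A →ₗ[ℂ] ℂ}

/-- The moment `φ(x_{i₁} ⋯ x_{iᵣ})` of the subword with index set `U = {i₁ < ⋯ < iᵣ}`. -/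
def mom (φ : A →ₗ[ℂ] ℂ) (x : ℕ → A) (U : Finset ℕ) : ℂ := φ (letters x U).prod

theorem mom_congr (h : ∀ i ∈ U, x i = y i) : mom φ x U = mom φ y U := by
  rw [mom, letters_congr h, mom]

theorem mom_singleton (x : ℕ → A) (i : ℕ) : mom φ x {i} = φ (x i) := by
  simp [mom, letters_singleton]

theorem prod_mapBlocks_mom (φ : A →ₗ[ℂ] ℂ) (x : ℕ → A) (e : Fin n ↪o ℕ) (π : Part n) :
    ∏ U ∈ mapBlocks e π, mom φ x U = partMoment φ π (x ∘ e) := by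
  simp only [prod_mapBlocks, mom, letters_map]
  rfl

end Subwords

section Cumulants

variable {A : Type*} [Ring A] [Algebra ℂ A] {φ : A →ₗ[ℂ] ℂ} {n : ℕ}

/-- The free cumulant of the entries of a list. -/
def listCumulant (φ : A →ₗ[ℂ] ℂ) (l : List A) : ℂ := freeCumulant φ l.length l.get

/-- The free cumulant of `x_{i₁}, …, x_{iᵣ}` for `U = {i₁ < ⋯ < iᵣ}`. -/
def cum (φ : A →ₗ[ℂ] ℂ) (x : ℕ → A) (U : Finset ℕ) : ℂ := listCumulant φ (letters x U)

theorem freeCumulant_cast (φ : A →ₗ[ℂ] ℂ) {m : ℕ} (h : m = n) (a : Fin n → A) :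
    freeCumulant φ m (a ∘ Fin.cast h) = freeCumulant φ n a := by
  subst h
  rfl

theorem listCumulant_ofFn (φ : A →ₗ[ℂ] ℂ) (a : Fin n → A) :
    listCumulant φ (List.ofFn a) = freeCumulant φ n a := by
  rw [← freeCumulant_cast φ List.length_ofFn a]
  exact congrArg _ (funext fun i => List.get_ofFn a i)

theorem prod_mapBlocks_cum (φ : A →ₗ[ℂ] ℂ) (x : ℕ → A) (e : Fin n ↪o ℕ) (π : Part n) :
    ∏ U ∈ mapBlocks e π, cum φ x U =
      ∏ V ∈ π.parts, freeCumulant φ V.card (restrict (x ∘ e) V) := by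
  simp only [prod_mapBlocks, cum, letters_map, listCumulant_ofFn]

theorem parts_top (hn : 0 < n) : (⊤ : Part n).parts = {univ} :=
  (subset_singleton_iff.1 (Finpartition.parts_top_subset _)).resolve_left fun h =>
    absurd ((⊤ : Part n).part_mem.2 (mem_univ ⟨0, hn⟩)) (h ▸ notMem_empty _)

theorem moment_eq_sum_freeCumulant (φ : A →ₗ[ℂ] ℂ) (hn : 0 < n) (a : Fin n → A) :
    moment φ a = ∑ π ∈ NC n, ∏ V ∈ π.parts, freeCumulant φ V.card (restrict a V) := by
  classical
  have htop : (⊤ : Part n) ∈ NC n := by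
    simp only [mem_NC, IsNonCrossing, parts_top hn, mem_singleton]
    rintro V rfl W rfl
    simp
  have hfull : freeCumulant φ (univ : Finset (Fin n)).card (restrict a univ) =
      freeCumulant φ n a := by
    rw [← freeCumulant_cast φ (card_fin n) a]
    have := orderEmbOfFin_unique (s := (univ : Finset (Fin n))) rfl (f := Fin.cast (by simp))
      (fun _ => mem_univ _) (Fin.cast_strictMono _)
    exact congrArg _ (funext fun i => congrArg a (congrFun this i).symm)
  have hrest : ∑ π : {π : Part n // π ∈ NC n ∧ π ≠ ⊤}, ∏ V : {V // V ∈ π.1.parts},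
      freeCumulant φ V.1.card (restrict a V.1) =
        ∑ π ∈ (NC n).erase ⊤, ∏ V ∈ π.parts, freeCumulant φ V.card (restrict a V) := by
    rw [sum_subtype (p := fun π => π ∈ NC n ∧ π ≠ ⊤) _ (by simp [and_comm])]
    exact sum_congr (by congr) fun π _ =>
      prod_coe_sort π.1.parts fun V => freeCumulant φ V.card (restrict a V)
  rw [← add_sum_erase _ _ htop, parts_top hn, prod_singleton, hfull, freeCumulant, ← hrest,
    sub_add_cancel]

theorem mom_eq_sum_ncPartitions (φ : A →ₗ[ℂ] ℂ) (x : ℕ → A) {s : Finset ℕ} (hs : s.Nonempty) :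
    mom φ x s = ∑ P ∈ ncPartitions s, ∏ U ∈ P, cum φ x U := by
  have hmap : univ.map (s.orderEmbOfFin rfl).toEmbedding = s := map_orderEmbOfFin_univ s rfl
  conv_rhs => rw [← hmap, ← sum_NC_mapBlocks]
  simp only [prod_mapBlocks_cum]
  rw [← moment_eq_sum_freeCumulant φ hs.card_pos, mom, moment, letters_eq_ofFn]

end Cumulants

section Semicircular

variable {A : Type*} [Ring A] [Algebra ℂ A] {φ : A →ₗ[ℂ] ℂ} {s : A}

theorem openSum_one {R : Type*} [CommSemiring R] (f : Finset ℕ → R) (p q : ℕ) :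
    openSum f 1 p q = ∑ P ∈ ncPartitions (Ioo p q), ∏ U ∈ P, f U := by
  simp [openSum, weight]

theorem mom_Ioo_eq_openSum (hφ : φ 1 = 1) (x : ℕ → A) {p q : ℕ} (hpq : p < q) :
    mom φ x (Ioo p q) = openSum (cum φ x) 1 p q := by
  rcases (Nat.succ_le_of_lt hpq).eq_or_lt with rfl | hpq
  · rw [openSum_succ]
    simp [mom, letters, show Ioo p p.succ = ∅ by grind, hφ]
  · rw [openSum_one, mom_eq_sum_ncPartitions φ x ⟨p + 1, by grind⟩]

theorem sum_ncPartitions_prod_injective {R : Type*} [CommRing R] {f f' : Finset ℕ → R}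
    {S : Finset ℕ} (hS : S.Nonempty) (hlt : ∀ U ⊂ S, U.Nonempty → f U = f' U)
    (hsum : ∑ P ∈ ncPartitions S, ∏ U ∈ P, f U = ∑ P ∈ ncPartitions S, ∏ U ∈ P, f' U) :
    f S = f' S := by
  have hmem : {S} ∈ ncPartitions S := mem_ncPartitions.2 ⟨by simpa, by simp, by simp⟩
  have hrest : ∀ P ∈ (ncPartitions S).erase {S}, ∏ U ∈ P, f U = ∏ U ∈ P, f' U := by
    intro P hP
    obtain ⟨hne, hP⟩ := mem_erase.1 hP
    rw [mem_ncPartitions] at hP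
    refine prod_congr rfl fun U hU =>
      hlt U ((hP.subset hU).ssubset_of_ne ?_) (hP.nonempty U hU)
    rintro rfl
    refine hne (eq_singleton_iff_unique_mem.2 ⟨hU, fun W hW => ?_⟩)
    obtain ⟨x, hx⟩ := hP.nonempty W hW
    exact hP.eq_of_mem hW hU hx (hP.subset hW hx)
  rwa [← add_sum_erase _ _ hmem, ← add_sum_erase _ _ hmem, sum_congr rfl hrest,
    add_left_inj, prod_singleton, prod_singleton] at hsum

theorem catalan_eq_factorial_div (k : ℕ) :
    (catalan k : ℂ) = ((2 * k).factorial : ℂ) / (k.factorial * (k + 1).factorial) := by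
  have hcentral : ((k : ℂ) + 1) * catalan k = k.centralBinom := by
    exact_mod_cast succ_mul_catalan_eq_centralBinom k
  have hfactorial : (k.centralBinom : ℂ) * (k.factorial * k.factorial) = (2 * k).factorial := by
    have := Nat.choose_mul_factorial_mul_factorial (show k ≤ 2 * k by omega)
    rw [show 2 * k - k = k by omega, mul_assoc, ← Nat.centralBinom_eq_two_mul_choose] at this
    exact_mod_cast this
  rw [eq_div_iff (by simp [Nat.factorial_ne_zero]), Nat.factorial_succ, ← hfactorial, ← hcentral]
  push_cast
  ring

theorem IsSemicircular.moment_two_mul (hs : IsSemicircular φ s) (k : ℕ) :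
    φ (s ^ (2 * k)) = catalan k := by
  rw [hs, if_pos (even_two_mul k), catalan_eq_factorial_div, Nat.mul_div_cancel_left k two_pos]

theorem IsSemicircular.moment_odd (hs : IsSemicircular φ s) {k : ℕ} (hk : ¬ Even k) :
    φ (s ^ k) = 0 := by
  rw [hs, if_neg hk]

theorem IsSemicircular.moment_add_two (hs : IsSemicircular φ s) (r : ℕ) :
    φ (s ^ (r + 2)) = ∑ i ∈ range (r + 1), φ (s ^ i) * φ (s ^ (r - i)) := by
  have hodd : ∀ i ∈ range (r + 1), φ (s ^ i) * φ (s ^ (r - i)) ≠ 0 → Even i ∧ Even (r - i) :=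
    fun i _ h => ⟨not_not.1 fun hi => h (by rw [hs.moment_odd hi, zero_mul]),
      not_not.1 fun hi => h (by rw [hs.moment_odd hi, mul_zero])⟩
  rw [← sum_filter_of_ne hodd]
  rcases Nat.even_or_odd' r with ⟨k, rfl | rfl⟩
  · rw [show 2 * k + 2 = 2 * (k + 1) by ring, hs.moment_two_mul, catalan_succ',
      Finset.Nat.sum_antidiagonal_eq_sum_range_succ fun i j => catalan i * catalan j]
    push_cast
    refine sum_bij (fun i _ => 2 * i) (by grind) (by grind) (fun i hi => ?_) fun i _ => ?_
    · obtain ⟨hi, ⟨j, rfl⟩, -⟩ := mem_filter.1 hi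
      exact ⟨j, by grind, by ring⟩
    · rw [← Nat.mul_sub, hs.moment_two_mul, hs.moment_two_mul]
  · rw [hs.moment_odd (by grind), sum_eq_zero]
    grind

theorem IsSemicircular.openSum_card_two (hφ : φ 1 = 1) (hs : IsSemicircular φ s) (p m : ℕ) :
    openSum (fun U => if #U = 2 then (1 : ℂ) else 0) 1 p (p + 1 + m) = φ (s ^ m) := by
  induction m using Nat.strong_induction_on generalizing p with
  | _ m ih =>
    match m with
    | 0 => rw [add_zero, openSum_succ, pow_zero, hφ, Pi.one_apply]
    | 1 =>
      rw [openSum_eq_sum_of_pairs (by omega) fun U _ _ hU => if_neg hU, hs.moment_odd (by simp),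
        show Ioo (p + 1) (p + 1 + 1) = ∅ by grind, sum_empty]
    | r + 2 =>
      rw [openSum_eq_sum_of_pairs (by omega) fun U _ _ hU => if_neg hU, hs.moment_add_two]
      refine (sum_bij (fun i _ => p + 1 + 1 + i) (by grind) (by grind)
        (fun j hj => ⟨j - (p + 1 + 1), by grind⟩) fun i hi => ?_).symm
      rw [mem_range] at hi
      have hsplit : p + 1 + (r + 2) = p + 1 + 1 + i + 1 + (r - i) := by omega
      rw [if_pos (card_pair (by omega)), one_mul, ih i (by omega), hsplit]
      exact congrArg _ (ih (r - i) (by omega) _).symm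

theorem IsSemicircular.listCumulant_replicate (hφ : φ 1 = 1) (hs : IsSemicircular φ s) {r : ℕ}
    (hr : 0 < r) : listCumulant φ (List.replicate r s) = if r = 2 then 1 else 0 := by
  induction r using Nat.strong_induction_on with
  | _ r ih =>
    have hcum : ∀ U : Finset ℕ, cum φ (fun _ => s) U = listCumulant φ (List.replicate #U s) :=
      fun U => by rw [cum, letters_const]
    have hcard : #(Ioo 0 (r + 1)) = r := by simp
    have := sum_ncPartitions_prod_injective (S := Ioo 0 (r + 1)) (f := cum φ fun _ => s)
      (f' := fun U => if #U = 2 then 1 else 0) ⟨1, by grind⟩ ?_ ?_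
    · rwa [hcum, hcard] at this
    · exact fun U hU hne => by rw [hcum, ih _ (hcard ▸ card_lt_card hU) hne.card_pos]
    · have := hs.openSum_card_two hφ 0 r
      rw [openSum_one, zero_add, add_comm] at this
      rw [← mom_eq_sum_ncPartitions φ _ ⟨1, by grind⟩, this, mom, letters_const, hcard,
        List.prod_replicate]

end Semicircular

section Freeness

variable {A ι : Type*} [Ring A] [Algebra ℂ A] {φ : A →ₗ[ℂ] ℂ} {s : A} {S : ι → Set A}
  {x : ℕ → A} {c : ℕ → ι}

theorem AreFree.coarsen {κ : Type*} {T : κ → Set A} (hfree : AreFree φ S) (f : ι → κ)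
    (hT : ∀ k, ∀ x ∈ T k, ∃ i, f i = k ∧ x ∈ S i) : AreFree φ T := by
  intro m a c ha ⟨i, j, hij⟩
  choose e hec he using fun i => hT _ _ (ha i)
  exact hfree m a e he ⟨i, j, fun h => hij (by rw [← hec i, ← hec j, h])⟩

theorem AreFree.cum_eq_zero (hfree : AreFree φ S) {U : Finset ℕ} (hx : ∀ i ∈ U, x i ∈ S (c i))
    {i j : ℕ} (hi : i ∈ U) (hj : j ∈ U) (hij : c i ≠ c j) : cum φ x U = 0 := by
  have hrange : ∀ k ∈ U, ∃ l, U.orderEmbOfFin rfl l = k := fun k hk => by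
    rw [← mem_coe, ← U.range_orderEmbOfFin rfl] at hk
    exact hk
  obtain ⟨i, rfl⟩ := hrange i hi
  obtain ⟨j, rfl⟩ := hrange j hj
  rw [cum, letters_eq_ofFn, listCumulant_ofFn]
  exact hfree _ _ (c ∘ U.orderEmbOfFin rfl) (fun k => hx _ (U.orderEmbOfFin_mem rfl k)) ⟨i, j, hij⟩

theorem AreFree.cum_eq_ite [DecidableEq ι] (hfree : AreFree φ S) (hφ : φ 1 = 1)
    (hs : IsSemicircular φ s) {c₀ : ι} (hS : S c₀ = {s}) {U : Finset ℕ}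
    (hx : ∀ i ∈ U, x i ∈ S (c i)) {p : ℕ} (hpU : p ∈ U) (hp : c p = c₀) :
    cum φ x U = if #U = 2 ∧ ∀ i ∈ U, c i = c₀ then 1 else 0 := by
  by_cases hc : ∀ i ∈ U, c i = c₀
  · have hxs : ∀ i ∈ U, x i = s := fun i hi => by
      have := hx i hi
      rwa [hc i hi, hS] at this
    rw [cum, letters_congr hxs, letters_const, hs.listCumulant_replicate hφ (card_pos.2 ⟨p, hpU⟩)]
    exact if_congr (and_iff_left hc).symm rfl rfl
  · rw [if_neg fun h => hc h.2]
    push Not at hc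
    obtain ⟨i, hi, hci⟩ := hc
    exact hfree.cum_eq_zero hx hpU hi (hp ▸ hci.symm)

theorem AreFree.mom_Ioo_eq_sum [DecidableEq ι] (hfree : AreFree φ S) (hφ : φ 1 = 1)
    (hs : IsSemicircular φ s) {c₀ : ι} (hS : S c₀ = {s}) {p q : ℕ}
    (hx : ∀ i ∈ Ioo p q, x i ∈ S (c i)) (hpq : p + 1 < q) (hp : c (p + 1) = c₀) :
    mom φ x (Ioo p q) =
      ∑ j ∈ Ioo (p + 1) q with c j = c₀, mom φ x (Ioo (p + 1) j) * mom φ x (Ioo j q) := by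
  have hcum : ∀ U ⊆ Ioo p q, p + 1 ∈ U →
      cum φ x U = if #U = 2 ∧ ∀ i ∈ U, c i = c₀ then 1 else 0 :=
    fun U hU hpU => hfree.cum_eq_ite hφ hs hS (fun i hi => hx i (hU hi)) hpU hp
  rw [mom_Ioo_eq_openSum hφ x (by omega), openSum_eq_sum_of_pairs hpq, sum_filter]
  · refine sum_congr rfl fun j hj => ?_
    obtain ⟨hpj, hjq⟩ := mem_Ioo.1 hj
    rw [hcum _ (by grind) (mem_insert_self _ _), mom_Ioo_eq_openSum hφ x hpj,
      mom_Ioo_eq_openSum hφ x hjq, card_pair hpj.ne]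
    simp only [true_and, forall_mem_insert, mem_singleton, forall_eq, hp, ite_mul,
      one_mul, zero_mul]
    rfl
  · exact fun U hU hpU hcard => by rw [hcum U hU hpU, if_neg fun h => hcard h.1]

end Freeness

section Concatenation

variable {α : Type*}

theorem letters_union (x : ℕ → α) {U W : Finset ℕ} (h : ∀ i ∈ U, ∀ j ∈ W, i < j) :
    letters x (U ∪ W) = letters x U ++ letters x W := by
  induction U using Finset.induction_on_min with
  | empty => simp [letters]
  | insert p U hp ih =>
    rw [insert_union, letters_insert_min x hp, letters_insert_min x, List.cons_append,
      ih fun i hi => h i (mem_insert_of_mem hi)]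
    exact fun i hi => (mem_union.1 hi).elim (hp i) (h p (mem_insert_self p U) i)

theorem letters_Ioo_eq (x : ℕ → α) (l : List α) (a : ℕ)
    (h : ∀ i (hi : i < l.length), x (a + 1 + i) = l[i]) :
    letters x (Ioo a (a + 1 + l.length)) = l := by
  induction l generalizing a with
  | nil => simp [letters, show Ioo a (a + 1) = ∅ by grind]
  | cons v l ih =>
    have hsplit : Ioo a (a + 1 + (v :: l).length) =
        insert (a + 1) (Ioo (a + 1) (a + 1 + 1 + l.length)) := by grind
    rw [hsplit, letters_insert_min x (by grind), h 0 (by simp), List.getElem_cons_zero,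
      ih (a + 1) fun i hi => ?_]
    rw [add_assoc, add_comm 1 i]
    exact h (i + 1) (Nat.succ_lt_succ hi)

theorem exists_mem_Ico_of_strictMono {c : ℕ → ℕ} (hc : StrictMono c) {i : ℕ} (hi : c 0 ≤ i) :
    ∃ k, i ∈ Ico (c k) (c (k + 1)) :=
  ⟨Nat.findGreatest (c · ≤ i) i, mem_Ico.2 ⟨Nat.findGreatest_spec (P := (c · ≤ i)) i.zero_le hi,
    not_le.1 fun h => Nat.findGreatest_is_greatest (Nat.lt_succ_self _) (hc.le_apply.trans h) h⟩⟩

theorem exists_letters_eq (a : α) (l : ℕ → List α) :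
    ∃ (x : ℕ → α) (c : ℕ → ℕ), StrictMono c ∧ c 0 = 1 ∧ (∀ k, x (c k) = a) ∧
      ∀ k, letters x (Ioo (c k) (c (k + 1))) = l k := by
  let c : ℕ → ℕ := fun k => 1 + ∑ i ∈ range k, ((l i).length + 1)
  have hc_succ : ∀ k, c (k + 1) = c k + 1 + (l k).length := fun k => by
    simp only [c, sum_range_succ]
    ring
  have hc : StrictMono c := strictMono_nat_of_lt_succ fun k => by rw [hc_succ]; omega
  have hblock : ∀ i, ∃ v, ∀ k j, i = c k + j → j ≤ (l k).length → v = (a :: l k).getD j a := by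
    intro i
    by_cases h : ∃ k j, i = c k + j ∧ j ≤ (l k).length
    · obtain ⟨k, j, rfl, hj⟩ := h
      refine ⟨(a :: l k).getD j a, fun k' j' hkj hj' => ?_⟩
      have hk : k < k' + 1 := hc.lt_iff_lt.1 (by rw [hc_succ]; omega)
      have hk' : k' < k + 1 := hc.lt_iff_lt.1 (by rw [hc_succ]; omega)
      obtain rfl : k = k' := by omega
      rw [Nat.add_left_cancel hkj]
    · exact ⟨a, fun k j hkj hj => absurd ⟨k, j, hkj, hj⟩ h⟩
  choose x hx using hblock
  refine ⟨x, c, hc, rfl, fun k => hx _ k 0 rfl (Nat.zero_le _), fun k => ?_⟩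
  rw [hc_succ]
  refine letters_Ioo_eq x _ _ fun i hi => ?_
  rw [hx _ k (i + 1) (by omega) hi, List.getD_cons_succ, List.getD_eq_getElem _ _ hi]

end Concatenation

section Interlace

variable {A : Type*} [Monoid A] {s : A} {y y' : ℕ → A} {p q : ℕ}

/-- The product `y_p s y_{p+1} s ⋯ s y_{q-1}`, for `p < q`. -/
def interlace (s : A) (y : ℕ → A) (p q : ℕ) : A :=
  y p * (letters (fun i => s * y i) (Ioo p q)).prod

theorem interlace_succ (s : A) (y : ℕ → A) (p : ℕ) : interlace s y p (p + 1) = y p := by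
  simp [interlace, letters, show Ioo p (p + 1) = ∅ by grind]

theorem interlace_eq_mul (s : A) (y : ℕ → A) (hpq : p + 1 < q) :
    interlace s y p q = y p * (s * interlace s y (p + 1) q) := by
  rw [interlace, show Ioo p q = insert (p + 1) (Ioo (p + 1) q) by grind,
    letters_insert_min _ (by grind), List.prod_cons, interlace, mul_assoc]

theorem interlace_succ_right (s : A) (y : ℕ → A) (hpq : p < q) :
    interlace s y p (q + 1) = interlace s y p q * (s * y q) := by
  rw [interlace, show Ioo p (q + 1) = Ioo p q ∪ {q} by grind, letters_union _ (by grind),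
    letters_singleton, List.prod_append, List.prod_singleton, ← mul_assoc, interlace]

theorem interlace_congr (hpq : p < q) (h : ∀ i ∈ Ico p q, y i = y' i) :
    interlace s y p q = interlace s y' p q := by
  rw [interlace, interlace, h p (by grind), letters_congr fun i hi => by rw [h i (by grind)]]

theorem interlace_comp_add_one (s : A) (y : ℕ → A) (hpq : p < q) :
    interlace s (fun i => y (i + 1)) p q = interlace s y (p + 1) (q + 1) := by
  induction q, hpq using Nat.le_induction with
  | base => simp only [Nat.succ_eq_add_one, interlace_succ]
  | succ q hpq ih =>
    rw [interlace_succ_right s _ hpq, ih, interlace_succ_right s _ (Nat.succ_lt_succ hpq)]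

theorem interlace_update_of_notMem (s a : A) (y : ℕ → A) (hpq : p < q) {j : ℕ}
    (hj : j ∉ Ico p q) : interlace s (Function.update y j a) p q = interlace s y p q :=
  interlace_congr hpq fun _ hi => Function.update_of_ne (ne_of_mem_of_not_mem hi hj) a y

theorem mul_interlace (s a : A) (y : ℕ → A) (p q : ℕ) :
    a * interlace s y p q = interlace s (Function.update y p (a * y p)) p q := by
  rw [interlace, interlace, Function.update_self, mul_assoc, letters_congr fun i hi => ?_]
  rw [Function.update_of_ne (by grind)]

theorem interlace_mul (s a : A) (y : ℕ → A) (hpq : p < q + 1) :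
    interlace s y p (q + 1) * a = interlace s (Function.update y q (y q * a)) p (q + 1) := by
  rcases (Nat.lt_succ_iff.1 hpq).eq_or_lt with rfl | hpq
  · simp only [interlace_succ, Function.update_self]
  · rw [interlace_succ_right s _ hpq, interlace_succ_right s _ hpq, Function.update_self,
      interlace_update_of_notMem s _ y hpq right_notMem_Ico]
    simp only [mul_assoc]

theorem prod_letters_eq_interlace {x : ℕ → A} {c : ℕ → ℕ} (hc : StrictMono c)
    (hs : ∀ k, x (c k) = s) (hy : ∀ k, (letters x (Ioo (c k) (c (k + 1)))).prod = y k)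
    (hpq : p < q) : (letters x (Ioo (c p) (c q))).prod = interlace s y p q := by
  obtain ⟨m, rfl⟩ := Nat.exists_eq_add_of_le (Nat.succ_le_of_lt hpq)
  induction m generalizing p with
  | zero => rw [add_zero, hy, interlace_succ]
  | succ m ih =>
    have hlt := hc (Nat.lt_add_one p)
    have hlt' : c (p + 1) < c (p.succ + (m + 1)) := hc (by omega)
    have hsplit : Ioo (c p) (c (p.succ + (m + 1))) = Ioo (c p) (c (p + 1)) ∪
        insert (c (p + 1)) (Ioo (c (p + 1)) (c (p.succ + (m + 1)))) := by grind
    rw [hsplit, letters_union _ (by grind), letters_insert_min _ (by grind), List.prod_append, hy,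
      List.prod_cons, hs, interlace_eq_mul _ _ (by omega),
      show p.succ + (m + 1) = (p + 1).succ + m by omega, ih (by omega)]

end Interlace

section SchwingerDyson

variable {A ι : Type*} [Ring A] {s : A} {S : ι → Set A} {c₀ : ι} {y : ℕ → A} {p q : ℕ}

theorem exists_list_of_mem_closure_ne {a : A} (ha : a ∈ Submonoid.closure (⋃ i ≠ c₀, S i)) :
    ∃ l : List (A × ι), (∀ z ∈ l, z.2 ≠ c₀ ∧ z.1 ∈ S z.2) ∧ (l.map Prod.fst).prod = a := by
  induction ha using Submonoid.closure_induction with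
  | mem a ha =>
    obtain ⟨i, hi, ha⟩ := Set.mem_iUnion₂.1 ha
    exact ⟨[(a, i)], by simpa using ⟨hi, ha⟩, by simp⟩
  | one => exact ⟨[], by simp, by simp⟩
  | mul a a' _ _ ih ih' =>
    obtain ⟨l, hl, rfl⟩ := ih
    obtain ⟨l', hl', rfl⟩ := ih'
    exact ⟨l ++ l', fun z hz => (List.mem_append.1 hz).elim (hl z) (hl' z), by simp⟩

theorem exists_prod_letters_eq_interlace (hs : s ∈ S c₀)
    (hy : ∀ i ∈ Ico p q, y i ∈ Submonoid.closure (⋃ i ≠ c₀, S i)) :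
    ∃ (x : ℕ → A) (e : ℕ → ι) (c : ℕ → ℕ), StrictMono c ∧ c 0 = 1 ∧ (∀ k, x (c k) = s) ∧
      (∀ i, 1 ≤ i → x i ∈ S (e i)) ∧ (∀ i, 1 ≤ i → (e i = c₀ ↔ i ∈ Set.range c)) ∧
      ∀ j k, p ≤ j → j < k → k ≤ q →
        (letters x (Ioo (c j) (c k))).prod = interlace s y j k := by
  have hlist : ∀ i, ∃ l : List (A × ι), (∀ z ∈ l, z.2 ≠ c₀ ∧ z.1 ∈ S z.2) ∧
      (i ∈ Ico p q → (l.map Prod.fst).prod = y i) := fun i =>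
    if hi : i ∈ Ico p q then
      (exists_list_of_mem_closure_ne (hy i hi)).imp fun _ h => ⟨h.1, fun _ => h.2⟩
    else ⟨[], by simp, fun h => absurd h hi⟩
  choose l hl hly using hlist
  obtain ⟨z, c, hc, hc0, hzc, hzl⟩ := exists_letters_eq (s, c₀) l
  have hcover : ∀ i, 1 ≤ i → i ∈ Set.range c ∨ (z i).2 ≠ c₀ ∧ (z i).1 ∈ S (z i).2 := by
    intro i hi
    obtain ⟨k, hk⟩ := exists_mem_Ico_of_strictMono hc (hc0.trans_le hi)
    obtain ⟨hki, hik⟩ := mem_Ico.1 hk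
    rcases hki.eq_or_lt with h | h
    · exact .inl ⟨k, h⟩
    · exact .inr (hl k _ (hzl k ▸ List.mem_map_of_mem ((mem_sort _).2 (mem_Ioo.2 ⟨h, hik⟩))))
  refine ⟨fun i => (z i).1, fun i => (z i).2, c, hc, hc0, fun k => congrArg Prod.fst (hzc k),
    fun i hi => ?_, fun i hi => ⟨fun h => (hcover i hi).resolve_right fun h' => h'.1 h, ?_⟩, ?_⟩
  · rcases hcover i hi with ⟨k, rfl⟩ | h
    · simpa only [hzc]
    · exact h.2
  · rintro ⟨k, rfl⟩
    exact congrArg Prod.snd (hzc k)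
  · intro j k hj hjk hk
    rw [prod_letters_eq_interlace (y := fun i => ((l i).map Prod.fst).prod) hc
      (fun i => congrArg Prod.fst (hzc i)) (fun i => ?_) hjk]
    · exact interlace_congr hjk fun i hi => hly i (by grind)
    · rw [← hzl, letters, letters, List.map_map]
      rfl

theorem AreFree.schwingerDyson [Algebra ℂ A] {φ : A →ₗ[ℂ] ℂ} (hfree : AreFree φ S)
    (hφ : φ 1 = 1) (hs : IsSemicircular φ s) (hS : S c₀ = {s}) (hpq : p < q)
    (hy : ∀ i ∈ Ico p q, y i ∈ Submonoid.closure (⋃ i ≠ c₀, S i)) :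
    φ (s * interlace s y p q) =
      ∑ k ∈ Ioo p q, φ (interlace s y p k) * φ (interlace s y k q) := by
  classical
  obtain ⟨x, e, c, hc, hc0, hxs, hxe, hec, hx⟩ :=
    exists_prod_letters_eq_interlace (hS.ge rfl) hy
  have hpos : ∀ k, 1 ≤ c k := fun k => hc0.ge.trans (hc.monotone k.zero_le)
  have hcp : c p - 1 + 1 = c p := Nat.sub_add_cancel (hpos p)
  have hcpq := hc hpq
  have hleft : mom φ x (Ioo (c p - 1) (c q)) = φ (s * interlace s y p q) := by
    rw [show Ioo (c p - 1) (c q) = insert (c p) (Ioo (c p) (c q)) by grind, mom,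
      letters_insert_min _ (by grind), List.prod_cons, hxs, hx p q le_rfl hpq le_rfl]
  have hfilter : {j ∈ Ioo (c p) (c q) | e j = c₀} = (Ioo p q).image c := by
    ext j
    simp only [mem_filter, mem_Ioo, mem_image]
    refine ⟨fun ⟨⟨hpj, hjq⟩, hj⟩ => ?_, ?_⟩
    · obtain ⟨k, rfl⟩ := (hec j ((hpos p).trans hpj.le)).1 hj
      exact ⟨k, ⟨hc.lt_iff_lt.1 hpj, hc.lt_iff_lt.1 hjq⟩, rfl⟩
    · rintro ⟨k, ⟨hpk, hkq⟩, rfl⟩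
      exact ⟨⟨hc hpk, hc hkq⟩, (hec _ (hpos k)).2 ⟨k, rfl⟩⟩
  rw [← hleft, hfree.mom_Ioo_eq_sum hφ hs hS (fun i hi => hxe i (by grind)) (by omega)
    (by rw [hcp]; exact (hec _ (hpos p)).2 ⟨p, rfl⟩), hcp, hfilter, sum_image hc.injective.injOn]
  refine sum_congr rfl fun k hk => ?_
  obtain ⟨hpk, hkq⟩ := mem_Ioo.1 hk
  rw [mom, mom, hx p k le_rfl hpk hkq.le, hx k q hpk.le hkq le_rfl]

end SchwingerDyson

section Alternate

variable {α : Type*}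

/-- The family `z` with `z_{2i} = b_i` and `z_{2i+1} = d_i`. -/
def alternate (b d : ℕ → α) (i : ℕ) : α := if i % 2 = 0 then b (i / 2) else d (i / 2)

theorem alternate_two_mul (b d : ℕ → α) (i : ℕ) : alternate b d (2 * i) = b i := by
  simp [alternate]

theorem alternate_two_mul_add_one (b d : ℕ → α) (i : ℕ) : alternate b d (2 * i + 1) = d i := by
  simp [alternate, Nat.add_mod, show (2 * i + 1) / 2 = i by omega]

theorem update_alternate_two_mul (b d : ℕ → α) (j : ℕ) (a : α) :
    Function.update (alternate b d) (2 * j) a = alternate (Function.update b j a) d := by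
  ext i
  simp only [Function.update_apply, alternate]
  grind

theorem update_alternate_two_mul_add_one (b d : ℕ → α) (j : ℕ) (a : α) :
    Function.update (alternate b d) (2 * j + 1) a = alternate b (Function.update d j a) := by
  ext i
  simp only [Function.update_apply, alternate]
  grind

end Alternate

section WordSums

variable {A : Type*} [Ring A] {s : A} {M : Submonoid A} {y : ℕ → A} {p q : ℕ}

theorem forall_update_mem {U : Finset ℕ} (hy : ∀ i ∈ U, y i ∈ M) {a : A} (ha : a ∈ M) (j : ℕ) :
    ∀ i ∈ U, Function.update y j a i ∈ M := by
  intro i hi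
  rcases eq_or_ne i j with rfl | hij
  · rwa [Function.update_self]
  · rw [Function.update_of_ne hij]
    exact hy i hi

theorem forall_mem_update_mul (hy : ∀ i ∈ Ico p q, y i ∈ M) {j : ℕ} (hpj : p + 1 < j)
    (hjq : j < q) : ∀ i ∈ Ico j q, Function.update y j (y p * y j) i ∈ M :=
  forall_update_mem (fun i hi => hy i (by grind)) (M.mul_mem (hy p (by grind)) (hy j (by grind))) j

variable [Algebra ℂ A] {φ : A →ₗ[ℂ] ℂ}

/-- The indicator of the two-element blocks. -/
def pairWeight (U : Finset ℕ) : ℂ := if #U = 2 then 1 else 0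

/-- The Schwinger–Dyson equations of a standard semicircular variable `s` free from `M`: deleting a
letter `s` of a word together with another one splits the word into two pieces. -/
def SchwingerDyson (φ : A →ₗ[ℂ] ℂ) (s : A) (M : Submonoid A) : Prop :=
  ∀ ⦃p q : ℕ⦄ ⦃y : ℕ → A⦄, p < q → (∀ i ∈ Ico p q, y i ∈ M) →
    φ (s * interlace s y p q) = ∑ k ∈ Ioo p q, φ (interlace s y p k) * φ (interlace s y k q)

theorem mom_adjoin (y : ℕ → A) {W : Finset ℕ} (hpq : p < q) (hW : ∀ i ∈ W, q ≤ i) :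
    mom φ y (adjoin p q W) = mom φ (Function.update y q (y p * y q)) W := by
  by_cases hq : q ∈ W
  · have hsplit : W = insert q (W.erase q) := (insert_erase hq).symm
    have hlt : ∀ i ∈ W.erase q, q < i := fun i hi =>
      (hW i (mem_of_mem_erase hi)).lt_of_ne' (ne_of_mem_erase hi)
    rw [adjoin, if_pos hq, mom, mom, letters_insert_min _ fun i hi => hpq.trans_le (hW i hi),
      hsplit, letters_insert_min _ hlt, letters_insert_min _ hlt, Function.update_self,
      letters_congr fun i hi =>
        (Function.update_of_ne (ne_of_mem_erase hi) (y p * y q) y).symm]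
    simp only [List.prod_cons, mul_assoc]
  · rw [adjoin, if_neg hq, mom_congr fun i hi => ?_]
    rw [Function.update_of_ne (ne_of_mem_of_not_mem hi hq)]

theorem openSum_mom_adjoin (f : Finset ℕ → ℂ) (y : ℕ → A) {j : ℕ} (hpj : p < j) :
    openSum f (mom φ y ∘ adjoin p j) j q =
      openSum f (mom φ (Function.update y j (y p * y j))) j q :=
  openSum_congr (fun _ _ => rfl) fun _ hW => mom_adjoin y hpj fun _ hi => (mem_Ico.1 (hW hi)).1

theorem closedSum_mom_adjoin (g : Finset ℕ → ℂ) (y : ℕ → A) {j : ℕ} (hpj : p < j) :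
    closedSum (mom φ y ∘ adjoin p j) g j q =
      closedSum (mom φ (Function.update y j (y p * y j))) g j q :=
  closedSum_congr (fun _ hU => mom_adjoin y hpj fun _ hi => (mem_Icc.1 (hU hi)).1) fun _ _ => rfl

theorem interlace_alternate_eq_openSum_succ (s : A) (b d : ℕ → A) (p : ℕ) :
    φ (interlace s (alternate b d) (2 * p + 1) (2 * (p + 1))) =
      openSum (mom φ b) (mom φ d) p (p + 1) := by
  rw [openSum_succ, mom_singleton, ← alternate_two_mul_add_one b d p]
  exact congrArg φ (interlace_succ s _ _)

theorem interlace_alternate_eq_closedSum_self (s : A) (b d : ℕ → A) (p : ℕ) :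
    φ (interlace s (alternate b d) (2 * p) (2 * p + 1)) =
      closedSum (mom φ b) (mom φ d) p p := by
  rw [interlace_succ, closedSum_self, mom_singleton, alternate_two_mul]

namespace SchwingerDyson

variable (hSD : SchwingerDyson φ s M) (hφ : ∀ x y : A, φ (x * y) = φ (y * x))
include hSD hφ

theorem interlace_eq_sum (hpq : p + 1 < q) (hy : ∀ i ∈ Ico p q, y i ∈ M) :
    φ (interlace s y p q) = ∑ j ∈ Ioo (p + 1) q,
      φ (interlace s y (p + 1) j) * φ (interlace s (Function.update y j (y p * y j)) j q) := by
  obtain ⟨r, rfl⟩ : ∃ r, q = r + 1 := ⟨q - 1, by omega⟩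
  have hz : ∀ i ∈ Ico (p + 1) (r + 1), Function.update y r (y r * y p) i ∈ M :=
    forall_update_mem (fun i hi => hy i (by grind))
      (M.mul_mem (hy r (by grind)) (hy p (by grind))) r
  rw [interlace_eq_mul s y hpq, hφ, mul_assoc, interlace_mul s (y p) y hpq, hSD hpq hz]
  refine sum_congr rfl fun j hj => ?_
  obtain ⟨hpj, hjr⟩ := mem_Ioo.1 hj
  rw [← mul_interlace, hφ (y p), interlace_mul s _ y hjr,
    interlace_update_of_notMem s _ y hpj (by grind)]

theorem interlace_eq_zero (hpq : p < q) (heven : Even (p + q)) (hy : ∀ i ∈ Ico p q, y i ∈ M) :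
    φ (interlace s y p q) = 0 := by
  induction h : q - p using Nat.strong_induction_on generalizing p q y with
  | _ m ih =>
    rw [hSD.interlace_eq_sum hφ (by grind) hy]
    refine sum_eq_zero fun j hj => ?_
    obtain ⟨hpj, hjq⟩ := mem_Ioo.1 hj
    by_cases hj : Even (j + q)
    · rw [ih _ (by omega) hjq hj (forall_mem_update_mul hy hpj hjq) rfl, mul_zero]
    · rw [ih _ (by omega) hpj (by grind) (fun i hi => hy i (by grind)) rfl, zero_mul]

theorem interlace_eq_openSum_pairings (hpq : p < q) (hy : ∀ i ∈ Ico p q, y i ∈ M) :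
    φ (interlace s y p q) = openSum pairWeight (mom φ y) p q := by
  induction h : q - p using Nat.strong_induction_on generalizing p q y with
  | _ m ih =>
    rcases (Nat.succ_le_of_lt hpq).eq_or_lt with rfl | hpq
    · rw [interlace_succ, openSum_succ, mom_singleton]
    · rw [hSD.interlace_eq_sum hφ hpq hy,
        openSum_eq_sum_of_pairs (f := pairWeight) hpq fun U _ _ hU => if_neg hU]
      refine sum_congr rfl fun j hj => ?_
      obtain ⟨hpj, hjq⟩ := mem_Ioo.1 hj
      have hpair : pairWeight {p + 1, j} = 1 := if_pos (card_pair hpj.ne)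
      rw [openSum_mom_adjoin _ y (by omega), hpair, one_mul,
        ih _ (by omega) hpj (fun i hi => hy i (by grind)) rfl,
        ih _ (by omega) hjq (forall_mem_update_mul hy hpj hjq) rfl]

variable {b d : ℕ → A}

theorem interlace_alternate_eq_sum_odd (hpq : p + 1 < q)
    (hy : ∀ i ∈ Ico (2 * p + 1) (2 * q), alternate b d i ∈ M) :
    φ (interlace s (alternate b d) (2 * p + 1) (2 * q)) =
      ∑ j ∈ Ioo p q, φ (interlace s (alternate b d) (2 * (p + 1)) (2 * j + 1)) *
        φ (interlace s (alternate b (Function.update d j (d p * d j))) (2 * j + 1) (2 * q)) := by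
  rw [hSD.interlace_eq_sum hφ (by omega) hy]
  refine (sum_of_injOn (2 * · + 1) (fun i _ j _ h => by grind) (fun j hj => by grind) ?_
    fun j _ => ?_).symm
  · intro j hj hodd
    obtain ⟨i, rfl | rfl⟩ := Nat.even_or_odd' j
    · rw [hSD.interlace_eq_zero hφ (by grind) (by grind) fun i hi => hy i (by grind), zero_mul]
    · exact absurd ⟨i, by grind, rfl⟩ hodd
  · simp only [update_alternate_two_mul_add_one, alternate_two_mul_add_one]
    rfl

theorem interlace_alternate_eq_sum_even (hpq : p < q)
    (hy : ∀ i ∈ Ico (2 * p) (2 * q + 1), alternate b d i ∈ M) :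
    φ (interlace s (alternate b d) (2 * p) (2 * q + 1)) =
      ∑ j ∈ Ioc p q, φ (interlace s (alternate b d) (2 * p + 1) (2 * j)) *
        φ (interlace s (alternate (Function.update b j (b p * b j)) d) (2 * j) (2 * q + 1)) := by
  rw [hSD.interlace_eq_sum hφ (by omega) hy]
  refine (sum_of_injOn (2 * ·) (fun i _ j _ h => by grind) (fun j hj => by grind) ?_
    fun j _ => ?_).symm
  · intro j hj heven
    obtain ⟨i, rfl | rfl⟩ := Nat.even_or_odd' j
    · exact absurd ⟨i, by grind, rfl⟩ heven
    · rw [hSD.interlace_eq_zero hφ (by grind) (by grind) fun i hi => hy i (by grind), zero_mul]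
  · simp only [update_alternate_two_mul, alternate_two_mul]

theorem interlace_alternate_eq_openSum_and_closedSum (m : ℕ) :
    (∀ (b d : ℕ → A) p q, q - p ≤ m → p < q →
      (∀ i ∈ Ico (2 * p + 1) (2 * q), alternate b d i ∈ M) →
      φ (interlace s (alternate b d) (2 * p + 1) (2 * q)) = openSum (mom φ b) (mom φ d) p q) ∧
    (∀ (b d : ℕ → A) p q, q - p ≤ m → p ≤ q →
      (∀ i ∈ Ico (2 * p) (2 * q + 1), alternate b d i ∈ M) →
      φ (interlace s (alternate b d) (2 * p) (2 * q + 1)) =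
        closedSum (mom φ b) (mom φ d) p q) := by
  induction m with
  | zero =>
    refine ⟨fun b d p q hm hpq => by omega, fun b d p q hm hpq _ => ?_⟩
    obtain rfl : p = q := by omega
    exact interlace_alternate_eq_closedSum_self s b d p
  | succ m ih =>
    obtain ⟨ih_open, ih_closed⟩ := ih
    have hopen : ∀ (b d : ℕ → A) p q, q - p ≤ m + 1 → p < q →
        (∀ i ∈ Ico (2 * p + 1) (2 * q), alternate b d i ∈ M) →
        φ (interlace s (alternate b d) (2 * p + 1) (2 * q)) =
          openSum (mom φ b) (mom φ d) p q := by
      intro b d p q hm hpq hy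
      rcases (Nat.succ_le_of_lt hpq).eq_or_lt with rfl | hpq
      · exact interlace_alternate_eq_openSum_succ s b d p
      rw [hSD.interlace_alternate_eq_sum_odd hφ hpq hy, openSum_eq_sum _ _ hpq]
      refine sum_congr rfl fun j hj => ?_
      obtain ⟨hpj, hjq⟩ := mem_Ioo.1 hj
      rw [openSum_mom_adjoin _ d hpj,
        ih_closed _ _ _ _ (by omega) hpj fun i hi => hy i (by grind),
        ih_open _ _ _ _ (by omega) hjq ?_]
      simpa only [update_alternate_two_mul_add_one, alternate_two_mul_add_one] using
        forall_mem_update_mul hy (j := 2 * j + 1) (by omega) (by omega)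
    refine ⟨hopen, fun b d p q hm hpq hy => ?_⟩
    rcases hpq.eq_or_lt with rfl | hpq
    · exact interlace_alternate_eq_closedSum_self s b d p
    rw [hSD.interlace_alternate_eq_sum_even hφ hpq hy, closedSum_eq_sum _ _ hpq]
    refine sum_congr rfl fun j hj => ?_
    obtain ⟨hpj, hjq⟩ := mem_Ioc.1 hj
    rw [closedSum_mom_adjoin _ b hpj,
      hopen _ _ _ _ (by omega) hpj fun i hi => hy i (by grind),
      ih_closed _ _ _ _ (by omega) hjq ?_]
    simpa only [update_alternate_two_mul, alternate_two_mul] using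
      forall_mem_update_mul hy (j := 2 * j) (by omega) (by omega)

theorem interlace_alternate_eq_openSum (hpq : p < q)
    (hy : ∀ i ∈ Ico (2 * p + 1) (2 * q), alternate b d i ∈ M) :
    φ (interlace s (alternate b d) (2 * p + 1) (2 * q)) = openSum (mom φ b) (mom φ d) p q :=
  (hSD.interlace_alternate_eq_openSum_and_closedSum hφ _).1 b d p q le_rfl hpq hy

end SchwingerDyson

end WordSums

section Kreweras

variable {A : Type*} [Ring A] [Algebra ℂ A] {φ : A →ₗ[ℂ] ℂ} {a n q : ℕ} {y : ℕ → A}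

/-- The embedding of `Fin n` onto the points `a + 1, …, a + n`. -/
def shiftEmb (a n : ℕ) : Fin n ↪o ℕ :=
  OrderEmbedding.ofStrictMono (fun i => i + (a + 1)) fun _ _ h => by simpa using h

theorem map_shiftEmb (a n : ℕ) : univ.map (shiftEmb a n).toEmbedding = Ioo a (a + n + 1) := by
  ext k
  simp only [mem_map, mem_univ, true_and, mem_Ioo]
  refine ⟨?_, fun hk => ⟨⟨k - (a + 1), by omega⟩, Nat.sub_add_cancel hk.1⟩⟩
  rintro ⟨i, rfl⟩
  change a < i + (a + 1) ∧ i + (a + 1) < a + n + 1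
  omega

theorem mom_adjoin_max (hφ : ∀ x y : A, φ (x * y) = φ (y * x)) (y : ℕ → A) {W : Finset ℕ}
    (hW : W ⊆ Ioc a q) :
    mom φ y (adjoin a q W) = mom φ (Function.update y q (y q * y a)) W := by
  by_cases hq : q ∈ W
  · have hsplit : W = W.erase q ∪ {q} := by rw [union_singleton, insert_erase hq]
    have hlt : ∀ i ∈ W.erase q, ∀ j ∈ ({q} : Finset ℕ), i < j := by grind
    rw [adjoin, if_pos hq, mom, mom, letters_insert_min _ fun i hi => (mem_Ioc.1 (hW hi)).1,
      hsplit, letters_union _ hlt, letters_union _ hlt, letters_singleton, letters_singleton,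
      Function.update_self, letters_congr fun i hi =>
        (Function.update_of_ne (ne_of_mem_erase hi) (y q * y a) y).symm, List.prod_cons, hφ]
    simp only [List.prod_append, List.prod_singleton, mul_assoc]
  · rw [adjoin, if_neg hq, mom_congr fun i hi => ?_]
    rw [Function.update_of_ne (ne_of_mem_of_not_mem hi hq)]

theorem prod_classes_mom (hφ : ∀ x y : A, φ (x * y) = φ (y * x)) (y : ℕ → A) (a : ℕ) (hn : 1 ≤ n)
    (π : Part n) :
    ∏ W ∈ classes (slotSetoid (mapBlocks (shiftEmb a n) π)) (Ico a (a + n + 1)), mom φ y W =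
      partMoment φ (kreweras π)
        (Function.update y (a + n) (y (a + n) * y a) ∘ shiftEmb a n) := by
  have hslots : Ico a (a + n + 1) = insert a (Ioo a (a + n + 1)) := by grind
  have hlinked : slotSetoid (mapBlocks (shiftEmb a n) π) a (a + n) := by
    intro U hU
    have hbound : ∀ x ∈ U, (x ≤ a ↔ x ≤ a + n) ↔ False := by
      obtain ⟨V, -, rfl⟩ := mem_mapBlocks.1 hU
      intro x hx
      have := map_shiftEmb a n ▸ map_subset_map.2 (subset_univ V) hx
      grind
    exact fun x hx y hy => (hbound x hx).trans (hbound y hy).symm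
  have hsub : ∀ W ∈ classes (slotSetoid (mapBlocks (shiftEmb a n) π)) (Ioo a (a + n + 1)),
      W ⊆ Ioc a (a + n) := fun W hW i hi => by
    have := subset_of_mem_classes hW hi
    grind
  rw [hslots, classes_insert (j := a + n) (by grind) hlinked,
    prod_image_adjoin fun W hW ha => absurd (hsub W hW ha) left_notMem_Ioc,
    ← prod_mapBlocks_mom, mapBlocks_kreweras, map_shiftEmb]
  exact prod_congr rfl fun W hW => mom_adjoin_max hφ y (hsub W hW)

theorem openSum_mom_eq_sum_NC (hφ : ∀ x y : A, φ (x * y) = φ (y * x)) (f : Finset ℕ → ℂ)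
    (y : ℕ → A) (a : ℕ) (hn : 1 ≤ n) :
    openSum f (mom φ y) a (a + n + 1) =
      ∑ π ∈ NC n, (∏ V ∈ π.parts, f (V.map (shiftEmb a n).toEmbedding)) *
        partMoment φ (kreweras π)
          (Function.update y (a + n) (y (a + n) * y a) ∘ shiftEmb a n) := by
  rw [openSum, ← map_shiftEmb, ← sum_NC_mapBlocks]
  simp only [weight, prod_classes_mom hφ y a hn, prod_mapBlocks]

end Kreweras

section Words

theorem alternate_comp_shiftEmb {α : Type*} (b d : ℕ → α) (n : ℕ) :
    alternate b d ∘ shiftEmb 1 (2 * n) = altTuple n b d := by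
  ext i
  change alternate b d (i + 2) = altTuple n b d i
  simp [alternate, altTuple]

variable {A : Type*} [Ring A] {s : A} {M : Submonoid A} {b d : ℕ → A} {k l n : ℕ}

theorem word_eq_interlace (s : A) (b d : ℕ → A) (hkl : k ≤ l) :
    word s b d k l = interlace s (alternate b d) (2 * k + 1) (2 * l + 1 + 1) := by
  induction l, hkl using Nat.le_induction with
  | base =>
    rw [interlace_succ, alternate_two_mul_add_one]
    simp [word]
  | succ l hkl ih =>
    rw [interlace_succ_right _ _ (by omega), show 2 * (l + 1) = 2 * l + 1 + 1 by ring,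
      interlace_succ_right _ _ (by omega), ← ih, show 2 * l + 1 + 1 = 2 * (l + 1) by ring,
      alternate_two_mul_add_one, alternate_two_mul, word, word,
      show l + 1 - k = l - k + 1 by omega, List.range'_concat, List.map_append,
      List.prod_append, show k + 1 + 1 * (l - k) = l + 1 by omega]
    simp [mul_assoc]

theorem alternate_mem (hb : ∀ i ∈ Ioc k l, b i ∈ M) (hd : ∀ i ∈ Icc k l, d i ∈ M) :
    ∀ i ∈ Ico (2 * k + 1) (2 * l + 1 + 1), alternate b d i ∈ M := by
  intro i hi
  obtain ⟨j, rfl | rfl⟩ := Nat.even_or_odd' i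
  · rw [alternate_two_mul]
    exact hb j (by grind)
  · rw [alternate_two_mul_add_one]
    exact hd j (by grind)

theorem update_alternate_eq_closeUp (b d : ℕ → A) (n : ℕ) :
    Function.update (alternate b d) (2 * n + 1) (alternate b d (2 * n + 1) * alternate b d 1) =
      alternate b (closeUp n d) := by
  rw [alternate_two_mul_add_one, update_alternate_two_mul_add_one]
  rfl

variable [Algebra ℂ A] {φ : A →ₗ[ℂ] ℂ}

theorem word_eq_word_rotate (hφ : ∀ x y : A, φ (x * y) = φ (y * x)) (s : A) (b d : ℕ → A)
    (hn : 1 ≤ n) : φ (word s b d 0 n) =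
      φ (word s (closeUp n d) (Function.update (fun i => b (i + 1)) n 1) 0 n) := by
  have hshift : interlace s (alternate b (closeUp n d)) (1 + 1) (2 * n + 1 + 1) =
      interlace s (alternate (closeUp n d) (Function.update (fun i => b (i + 1)) n 1)) 1
        (2 * n + 1) := by
    rw [← interlace_comp_add_one s _ (by omega)]
    refine interlace_congr (by omega) fun i hi => ?_
    simp only [alternate, Function.update_apply]
    grind
  have hlast : alternate (closeUp n d) (Function.update (fun i => b (i + 1)) n 1) (2 * n + 1) =
      1 := by
    rw [alternate_two_mul_add_one, Function.update_self]
  rw [word_eq_interlace s b d n.zero_le, word_eq_interlace s _ _ n.zero_le, mul_zero, zero_add,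
    interlace_eq_mul s _ (by omega), hφ, mul_assoc, interlace_mul s _ _ (by omega),
    update_alternate_eq_closeUp, hφ, hshift,
    interlace_succ_right s _ (q := 2 * n + 1) (by omega), hlast, mul_one]

namespace SchwingerDyson

variable (hSD : SchwingerDyson φ s M) (hφ : ∀ x y : A, φ (x * y) = φ (y * x))
include hSD hφ

theorem word_eq_openSum_pairings (hkl : k ≤ l) (hb : ∀ i ∈ Ioc k l, b i ∈ M)
    (hd : ∀ i ∈ Icc k l, d i ∈ M) :
    φ (word s b d k l) = openSum pairWeight (mom φ (alternate b d))
      (2 * k + 1) (2 * l + 1 + 1) := by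
  rw [word_eq_interlace s b d hkl,
    hSD.interlace_eq_openSum_pairings hφ (by omega) (alternate_mem hb hd)]

theorem word_eq_sum_NC₂ (hn : 1 ≤ n) (hb : ∀ i ∈ Ioc 0 n, b i ∈ M)
    (hd : ∀ i ∈ Icc 0 n, d i ∈ M) :
    φ (word s b d 0 n) =
      ∑ π ∈ NC₂ (2 * n), partMoment φ (kreweras π) (altTuple n b (closeUp n d)) := by
  rw [hSD.word_eq_openSum_pairings hφ n.zero_le hb hd, mul_zero, zero_add, add_comm (2 * n),
    openSum_mom_eq_sum_NC hφ _ _ _ (by omega), add_comm 1, update_alternate_eq_closeUp,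
    alternate_comp_shiftEmb, NC₂, sum_filter]
  refine sum_congr rfl fun π _ => ?_
  simp only [pairWeight, card_map, prod_ite_zero, prod_const_one, ite_mul, one_mul, zero_mul]

theorem word_eq_sum_NC (hn : 1 ≤ n) (hb : ∀ i ∈ Ioc 0 n, b i ∈ M)
    (hd : ∀ i ∈ Icc 0 n, d i ∈ M) :
    φ (word s b d 0 n) = ∑ π ∈ NC n, partMoment φ π (tuple n b) *
      partMoment φ (kreweras π) (tuple n (closeUp n d)) := by
  have hsum := openSum_mom_eq_sum_NC hφ (mom φ b) d 0 hn
  simp only [← prod_mapBlocks, prod_mapBlocks_mom, zero_add] at hsum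
  rw [word_eq_interlace s b d n.zero_le]
  exact (hSD.interlace_alternate_eq_openSum hφ n.succ_pos (alternate_mem hb hd)).trans hsum

theorem word_eq_sum_NC_rotate (hn : 1 ≤ n) (hb : ∀ i ∈ Ioc 0 n, b i ∈ M)
    (hd : ∀ i ∈ Icc 0 n, d i ∈ M) :
    φ (word s b d 0 n) = ∑ π ∈ NC n, partMoment φ π (tuple n (closeUp n d)) *
      partMoment φ (kreweras π) (rotTuple n b) := by
  have hrot : tuple n (closeUp n (Function.update (fun i => b (i + 1)) n 1)) = rotTuple n b := by
    ext i
    rcases (Nat.add_one_le_of_lt i.2).eq_or_lt with hi | hi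
    · simp [tuple, rotTuple, closeUp, hi, show 0 ≠ n by omega]
    · simp [tuple, rotTuple, closeUp, Nat.mod_eq_of_lt hi, hi.ne]
  rw [word_eq_word_rotate hφ s b d hn, hSD.word_eq_sum_NC hφ hn, hrot]
  · refine fun i hi => forall_update_mem (fun i hi => hd i (by grind))
      (M.mul_mem (hd n (by grind)) (hd 0 (by grind))) n i hi
  · refine fun i hi => ?_
    rcases eq_or_ne i n with rfl | hin
    · simp
    · simpa [hin] using hb (i + 1) (by grind)

end SchwingerDyson

end Words

section Chains

variable {t : ℕ} {c : ℕ → ℕ} {U : Finset ℕ} {i j : ℕ}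

/-- The indicator of the pairs compatible with the chain `{c₀ + 1, c₁}, …, {cₜ₋₁ + 1, cₜ}` closed by
`{c₀, cₜ + 1}`: a pair that contains one of `c₀ + 1, …, cₜ₋₁ + 1, c₀` belongs to the chain. -/
def chainWeight (t : ℕ) (c : ℕ → ℕ) (U : Finset ℕ) : ℂ :=
  if #U = 2 ∧ (∀ i < t, c i + 1 ∈ U → U = {c i + 1, c (i + 1)}) ∧
    (c 0 ∈ U → U = {c 0, c t + 1}) then 1 else 0

theorem chain_mono (hc : ∀ i < t, c i + 1 < c (i + 1)) (hij : i ≤ j) (hj : j ≤ t) :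
    c i ≤ c j := by
  induction j, hij using Nat.le_induction with
  | base => rfl
  | succ j _ ih => exact (ih (by omega)).trans (by linarith [hc j hj])

theorem chain_lt (hc : ∀ i < t, c i + 1 < c (i + 1)) (hij : i < j) (hj : j ≤ t) :
    c i + 1 < c j :=
  (hc i (hij.trans_le hj)).trans_le (chain_mono hc hij hj)

theorem chainWeight_step (hc : ∀ i < t, c i + 1 < c (i + 1)) (hi : i < t) :
    chainWeight t c {c i + 1, c (i + 1)} = 1 := by
  have hlt := hc i hi
  have h0 := chain_mono hc i.zero_le hi.le
  refine if_pos ⟨card_pair hlt.ne, fun j hj hmem => ?_, fun hmem => by grind⟩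
  rcases lt_trichotomy j i with hji | rfl | hij
  · grind [chain_lt hc hji hi.le]
  · rfl
  · have := chain_mono hc (i := i + 1) hij hj.le
    grind

theorem chainWeight_closing (hc : ∀ i < t, c i + 1 < c (i + 1)) :
    chainWeight t c {c 0, c t + 1} = 1 := by
  have h0 : ∀ i ≤ t, c 0 ≤ c i := fun i hi => chain_mono hc i.zero_le hi
  refine if_pos ⟨card_pair (by grind), fun j hj hmem => ?_, fun _ => rfl⟩
  grind [chain_lt hc hj le_rfl]

theorem chainWeight_of_subset_Ioo (hc : ∀ i < t, c i + 1 < c (i + 1)) (hi : i ≤ t)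
    (hj : i < t → j ≤ c (i + 1)) (hU : U ⊆ Ioo (c i + 1) j) :
    chainWeight t c U = pairWeight U := by
  have h0 := chain_mono hc i.zero_le hi
  refine if_congr (and_iff_left ⟨fun l hl hmem => ?_, fun hmem => ?_⟩) rfl rfl
  · have hlt := mem_Ioo.1 (hU hmem)
    rcases le_or_gt l i with hli | hil
    · have := chain_mono hc hli hi
      omega
    · have := chain_mono hc (i := i + 1) hil hl.le
      have := hj (by omega)
      omega
  · have := mem_Ioo.1 (hU hmem)
    omega

theorem prod_map_update_mul {A : Type*} [Monoid A] (y : ℕ → A) {i m : ℕ}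
    (hc : ∀ l ∈ List.range' (i + 1 + 1) m, c l ≠ c (i + 1)) :
    ((List.range' (i + 1) (m + 1)).map
      (Function.update y (c (i + 1)) (y (c i) * y (c (i + 1))) ∘ c)).prod =
      ((List.range' i (m + 1 + 1)).map (y ∘ c)).prod := by
  have htail : (List.range' (i + 1 + 1) m).map
      (Function.update y (c (i + 1)) (y (c i) * y (c (i + 1))) ∘ c) =
      (List.range' (i + 1 + 1) m).map (y ∘ c) :=
    List.map_congr_left fun l hl => Function.update_of_ne (hc l hl) _ y
  simp only [List.range'_succ, List.map_cons, List.prod_cons, htail, Function.comp_apply,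
    Function.update_self, mul_assoc]

variable {A : Type*} [Ring A] [Algebra ℂ A] {φ : A →ₗ[ℂ] ℂ} {p q : ℕ}

theorem openSum_chainWeight_of_le (hc : ∀ i < t, c i + 1 < c (i + 1)) (hi : i ≤ t) (y : ℕ → A) :
    openSum (chainWeight t c) (mom φ y) (c i) (c t + 1) =
      φ ((List.range' i (t + 1 - i)).map (y ∘ c)).prod *
        ∏ l ∈ Ico i t, openSum pairWeight (mom φ y) (c l + 1)
          (c (l + 1)) := by
  induction hi using Nat.decreasingInduction generalizing y with
  | self => simp [openSum_succ, mom_singleton]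
  | of_succ i hi ih =>
    have hlt := hc i hi
    set z := Function.update y (c (i + 1)) (y (c i) * y (c (i + 1)))
    have hword : ((List.range' (i + 1) (t + 1 - (i + 1))).map (z ∘ c)).prod =
        ((List.range' i (t + 1 - i)).map (y ∘ c)).prod := by
      rw [show t + 1 - (i + 1) = t - (i + 1) + 1 by omega,
        show t + 1 - i = t - (i + 1) + 1 + 1 by omega, prod_map_update_mul]
      intro l hl
      obtain ⟨hil, hlt⟩ := List.mem_range'_1.1 hl
      exact ((Nat.le_add_right _ 1).trans_lt (chain_lt hc hil (by omega))).ne'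
    have hgaps : ∀ l ∈ Ico (i + 1) t,
        openSum pairWeight (mom φ z) (c l + 1) (c (l + 1)) =
          openSum pairWeight (mom φ y) (c l + 1) (c (l + 1)) := by
      refine fun l hl => openSum_congr (fun _ _ => rfl) fun W hW => mom_congr fun j hj => ?_
      have := chain_mono hc (mem_Ico.1 hl).1 (mem_Ico.1 hl).2.le
      exact Function.update_of_ne (by grind) _ y
    have hgap : openSum (chainWeight t c) (mom φ y) (c i + 1) (c (i + 1)) =
        openSum pairWeight (mom φ y) (c i + 1) (c (i + 1)) :=
      openSum_congr (fun U hU => chainWeight_of_subset_Ioo hc hi.le (fun _ => le_rfl) hU)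
        fun _ _ => rfl
    rw [openSum_eq_mul_of_pair hlt (Nat.lt_succ_of_le (chain_mono hc hi le_rfl))
        (by grind [chainWeight]),
      chainWeight_step hc hi, one_mul, openSum_mom_adjoin _ y (by omega), ih, hword, hgap,
      prod_congr rfl hgaps, prod_eq_prod_Ico_succ_bot hi]
    ring

theorem openSum_chainWeight (hc : ∀ i < t, c i + 1 < c (i + 1)) (hp : c 0 = p + 1)
    (hq : c t + 1 < q) (y : ℕ → A) :
    openSum (chainWeight t c) (mom φ y) p q =
      φ ((List.range (t + 1)).map (y ∘ c)).prod *
        ((∏ l ∈ range t, openSum pairWeight (mom φ y) (c l + 1)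
          (c (l + 1))) *
        openSum pairWeight
          (mom φ (Function.update y (c t + 1) (y p * y (c t + 1)))) (c t + 1) q) := by
  have h0 := chain_mono hc t.zero_le le_rfl
  rw [openSum_eq_mul_of_pair (j := c t + 1) (by omega) hq (by grind [chainWeight]), ← hp,
    chainWeight_closing hc, one_mul, openSum_chainWeight_of_le hc t.zero_le,
    openSum_mom_adjoin _ y (by omega), openSum_congr
      (fun U hU => chainWeight_of_subset_Ioo hc le_rfl (fun h => absurd h (lt_irrefl t)) hU)
      fun _ _ => rfl, Nat.sub_zero, ← List.range_eq_range', Nat.Ico_zero_eq_range, mul_assoc]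

end Chains

section ChainPairings

variable {m n t : ℕ} {k : ℕ → ℕ}

theorem hasPair_comm {π : Part m} {p q : ℕ} : HasPair π p q ↔ HasPair π q p := by
  rw [HasPair, pair_comm, HasPair]

theorem hasPair_iff {π : Part m} {p q : ℕ} (hp : 1 ≤ p) (hpm : p ≤ m) :
    HasPair π p q ↔ ∀ V ∈ π.parts, p + 1 ∈ V.map (shiftEmb 1 m).toEmbedding →
      V.map (shiftEmb 1 m).toEmbedding = {p + 1, q + 1} := by
  have hlabels : ∀ V : Finset (Fin m), V.map (shiftEmb 1 m).toEmbedding = {p + 1, q + 1} ↔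
      V.image (fun x : Fin m => (x : ℕ) + 1) = {p, q} := by
    intro V
    rw [← (image_injective Nat.succ_injective).eq_iff (b := {p, q}), image_image, map_eq_image,
      image_insert, image_singleton]
    rfl
  have hmem : ∀ V : Finset (Fin m), p + 1 ∈ V.map (shiftEmb 1 m).toEmbedding ↔
      ⟨p - 1, by omega⟩ ∈ V := by
    intro V
    rw [← mem_map' (shiftEmb 1 m).toEmbedding]
    change _ ↔ p - 1 + 2 ∈ _
    rw [show p - 1 + 2 = p + 1 by omega]
  simp only [HasPair, hlabels, hmem]
  constructor
  · rintro ⟨V, hV, hVpq⟩ W hW hpW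
    have hpV := (hmem V).1 ((hlabels V).2 hVpq ▸ mem_insert_self _ _)
    rwa [π.eq_of_mem_parts hW hV hpW hpV]
  · intro h
    exact ⟨_, π.part_mem.2 (mem_univ _), h _ (π.part_mem.2 (mem_univ _))
      (π.mem_part (mem_univ _))⟩

theorem prod_chainWeight (hk0 : 0 < k 0) (hk : ∀ i < t, k i < k (i + 1)) (hkn : k t ≤ n)
    {π : Part (2 * n)} (hπ : π ∈ NC (2 * n)) :
    ∏ V ∈ π.parts, chainWeight t (fun i => 2 * k i) (V.map (shiftEmb 1 (2 * n)).toEmbedding) =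
      if π ∈ chainPairings n t k then 1 else 0 := by
  have hc : ∀ i < t, 2 * k i + 1 < 2 * k (i + 1) := fun i hi => by linarith [hk i hi]
  have hbound : ∀ i ≤ t, 1 ≤ k i ∧ k i ≤ n := fun i hi => by
    have := chain_mono (c := (2 * k ·)) hc i.zero_le hi
    have := chain_mono (c := (2 * k ·)) hc hi le_rfl
    grind
  have hstep : ∀ i < t, (HasPair π (2 * k i) (2 * k (i + 1) - 1) ↔ ∀ V ∈ π.parts,
      2 * k i + 1 ∈ V.map (shiftEmb 1 (2 * n)).toEmbedding →
        V.map (shiftEmb 1 (2 * n)).toEmbedding = {2 * k i + 1, 2 * k (i + 1)}) := by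
    intro i hi
    have := hbound i hi.le
    have := hk i hi
    rw [hasPair_iff (by omega) (by omega), Nat.sub_add_cancel (by omega)]
  have hclosing : HasPair π (2 * k t) (2 * k 0 - 1) ↔ ∀ V ∈ π.parts,
      2 * k 0 ∈ V.map (shiftEmb 1 (2 * n)).toEmbedding →
        V.map (shiftEmb 1 (2 * n)).toEmbedding = {2 * k 0, 2 * k t + 1} := by
    have := hbound 0 t.zero_le
    rw [hasPair_comm, hasPair_iff (by omega) (by omega), Nat.sub_add_cancel (by omega)]
  simp only [chainWeight, prod_ite_zero, prod_const_one, card_map, chainPairings, NC₂, mem_filter,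
    hclosing, forall₂_congr hstep, hπ, true_and]
  exact if_congr (by grind) rfl rfl

variable {A : Type*} [Ring A] [Algebra ℂ A] {φ : A →ₗ[ℂ] ℂ}

theorem sum_chainPairings (hφ : ∀ x y : A, φ (x * y) = φ (y * x)) (b d : ℕ → A) (hk0 : 0 < k 0)
    (hk : ∀ i < t, k i < k (i + 1)) (hkn : k t ≤ n) :
    ∑ π ∈ chainPairings n t k, partMoment φ (kreweras π) (altTuple n b (closeUp n d)) =
      openSum (chainWeight t (2 * k ·)) (mom φ (alternate b d)) 1 (2 * n + 1 + 1) := by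
  have hn : 1 ≤ 2 * n := by
    have := chain_mono (c := (2 * k ·)) (fun i hi => by linarith [hk i hi]) t.zero_le le_rfl
    grind
  have hsub : chainPairings n t k ⊆ NC (2 * n) := fun π hπ => by
    simp only [chainPairings, NC₂, mem_filter] at hπ
    exact hπ.1.1
  rw [add_comm (2 * n), openSum_mom_eq_sum_NC hφ _ _ _ hn, add_comm 1,
    update_alternate_eq_closeUp, alternate_comp_shiftEmb,
    ← inter_eq_right.2 hsub, ← sum_ite_mem]
  refine sum_congr rfl fun π hπ => ?_
  rw [prod_chainWeight hk0 hk hkn hπ, ite_mul, one_mul, zero_mul]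

theorem word_update_eq_word_closeUp (hφ : ∀ x y : A, φ (x * y) = φ (y * x)) (s : A)
    (b d : ℕ → A) {l : ℕ} (hl : l ≤ n) :
    φ (word s b (Function.update d l (d 0 * d l)) l n) = φ (word s b (closeUp n d) l n) := by
  rw [word_eq_interlace s b _ hl, word_eq_interlace s b _ hl, ← update_alternate_eq_closeUp,
    ← update_alternate_two_mul_add_one, ← alternate_two_mul_add_one b d l, ← mul_interlace, hφ,
    interlace_mul s _ _ (by omega)]
  simp [alternate]

namespace SchwingerDyson

variable {s : A} {M : Submonoid A} {b d : ℕ → A} (hSD : SchwingerDyson φ s M)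
  (hφ : ∀ x y : A, φ (x * y) = φ (y * x))
include hSD hφ

theorem sum_chainPairings_eq_prod (hb : ∀ i ∈ Ioc 0 n, b i ∈ M) (hd : ∀ i ∈ Icc 0 n, d i ∈ M)
    (hk0 : k 0 = 1) (hk : ∀ i < t, k i < k (i + 1)) (hkn : k t ≤ n) :
    ∑ π ∈ chainPairings n t k, partMoment φ (kreweras π) (altTuple n b (closeUp n d)) =
      φ ((List.range (t + 1)).map fun i => b (k i)).prod *
        ((∏ i ∈ range t, φ (word s b d (k i) (k (i + 1) - 1))) *
          φ (word s b (closeUp n d) (k t) n)) := by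
  have hc : ∀ i < t, 2 * k i + 1 < 2 * k (i + 1) := fun i hi => by linarith [hk i hi]
  rw [sum_chainPairings hφ b d (by omega) hk hkn,
    openSum_chainWeight (c := (2 * k ·)) hc (by omega) (by omega)]
  congr 1
  · simp [Function.comp_def, alternate_two_mul]
  congr 1
  · refine prod_congr rfl fun i hi => ?_
    have := hk i (mem_range.1 hi)
    have := chain_mono (c := (2 * k ·)) hc (mem_range.1 hi) le_rfl
    rw [hSD.word_eq_openSum_pairings hφ (by omega) (fun j hj => hb j (by grind))
      (fun j hj => hd j (by grind))]
    congr 1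
    omega
  · rw [← word_update_eq_word_closeUp hφ s b d hkn,
      hSD.word_eq_openSum_pairings hφ hkn (fun j hj => hb j (by grind))
      (forall_update_mem (fun j hj => hd j (by grind))
        (M.mul_mem (hd 0 (by grind)) (hd _ (by grind))) _),
      update_alternate_two_mul_add_one, alternate_two_mul_add_one,
      ← alternate_two_mul_add_one b d 0]

end SchwingerDyson

end ChainPairings

end FreeMoments

end

open FreeMoments in
theorem lemma5p1_general {A : Type*} [Ring A] [Algebra ℂ A] (φ : A →ₗ[ℂ] ℂ) (hφ_one : φ 1 = 1)
    (hφ_trace : ∀ x y : A, φ (x * y) = φ (y * x))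
    (n : ℕ) (hn : 1 ≤ n) (s : A) (b d : ℕ → A) (hs : IsSemicircular φ s)
    (hfree : AreFree φ ![{s}, b '' Set.Icc 1 n ∪ d '' Set.Icc 0 n]) :
    (φ (word s b d 0 n) =
        ∑ π ∈ NC₂ (2 * n), partMoment φ (kreweras π) (altTuple n b (closeUp n d)) ∧
      φ (word s b d 0 n) =
        ∑ π ∈ NC n, partMoment φ π (tuple n b) *
          partMoment φ (kreweras π) (tuple n (closeUp n d)) ∧
      φ (word s b d 0 n) =
        ∑ π ∈ NC n, partMoment φ π (tuple n (closeUp n d)) *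
          partMoment φ (kreweras π) (rotTuple n b)) ∧
    ∀ (t : ℕ) (k : ℕ → ℕ), k 0 = 1 → (∀ i < t, k i < k (i + 1)) → k t ≤ n →
      ∑ π ∈ chainPairings n t k, partMoment φ (kreweras π) (altTuple n b (closeUp n d)) =
        φ ((List.range (t + 1)).map fun i => b (k i)).prod *
          ((∏ i ∈ Finset.range t, φ (word s b d (k i) (k (i + 1) - 1))) *
            φ (word s b (closeUp n d) (k t) n)) := by
  set M := Submonoid.closure (⋃ i ≠ (0 : Fin 2), (![{s}, b '' Set.Icc 1 n ∪ d '' Set.Icc 0 n] :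
    Fin 2 → Set A) i)
  have hSD : SchwingerDyson φ s M := fun p q y => hfree.schwingerDyson hφ_one hs rfl
  have hb : ∀ i ∈ Finset.Ioc 0 n, b i ∈ M := fun i hi => Submonoid.subset_closure <|
    Set.mem_iUnion₂.2 ⟨1, by decide, .inl ⟨i, Finset.mem_Ioc.1 hi, rfl⟩⟩
  have hd : ∀ i ∈ Finset.Icc 0 n, d i ∈ M := fun i hi => Submonoid.subset_closure <|
    Set.mem_iUnion₂.2 ⟨1, by decide, .inr ⟨i, Finset.mem_Icc.1 hi, rfl⟩⟩
  exact ⟨⟨hSD.word_eq_sum_NC₂ hφ_trace hn hb hd, hSD.word_eq_sum_NC hφ_trace hn hb hd,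
    hSD.word_eq_sum_NC_rotate hφ_trace hn hb hd⟩,
    fun t k => hSD.sum_chainPairings_eq_prod hφ_trace hb hd⟩

open FreeMoments in
theorem lemma5p1 {A : Type*} [Ring A] [Algebra ℂ A] (φ : A →ₗ[ℂ] ℂ) (hφ_one : φ 1 = 1)
    (hφ_trace : ∀ x y : A, φ (x * y) = φ (y * x))
    (n : ℕ) (hn : 1 ≤ n) (s : A) (b d : ℕ → A) (hs : IsSemicircular φ s)
    (hfree : AreFree φ ![{s}, b '' Set.Icc 1 n, d '' Set.Icc 0 n]) :
    (φ (word s b d 0 n) =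
        ∑ π ∈ NC₂ (2 * n), partMoment φ (kreweras π) (altTuple n b (closeUp n d)) ∧
      φ (word s b d 0 n) =
        ∑ π ∈ NC n, partMoment φ π (tuple n b) *
          partMoment φ (kreweras π) (tuple n (closeUp n d)) ∧
      φ (word s b d 0 n) =
        ∑ π ∈ NC n, partMoment φ π (tuple n (closeUp n d)) *
          partMoment φ (kreweras π) (rotTuple n b)) ∧
    ∀ (t : ℕ) (k : ℕ → ℕ), k 0 = 1 → (∀ i < t, k i < k (i + 1)) → k t ≤ n →
      ∑ π ∈ chainPairings n t k, partMoment φ (kreweras π) (altTuple n b (closeUp n d)) =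
        φ ((List.range (t + 1)).map fun i => b (k i)).prod *
          ((∏ i ∈ Finset.range t, φ (word s b d (k i) (k (i + 1) - 1))) *
            φ (word s b (closeUp n d) (k t) n)) := by
  refine lemma5p1_general φ hφ_one hφ_trace n hn s b d hs
    (hfree.coarsen ![0, 1, 1] fun k x hx => ?_)
  fin_cases k
  exacts [⟨0, rfl, hx⟩, hx.elim (⟨1, rfl, ·⟩) (⟨2, rfl, ·⟩)]
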